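/- Let $r,n,k\ge 0$ be integers and let $Q:\mathbb{Z}^{2r}\to\mathbb{Z}$ be a positive definite integral quadratic form, with bilinear form $B(x,y)=Q(x+y)-Q(x)-Q(y)$ (so $B(x,x)=2Q(x)$) and matrix $A=(B(e_i,e_j))$; extend $Q$ and $B$ (bi)linearly to $\mathbb{C}^{2r}$. Let $N$ be the level of $A$, i.e. the least integer $N\ge 1$ such that $NA^{-1}$ has integral entries and even diagonal entries. Let $h_1,\dots,h_n\in\mathbb{Z}^{2r}$ be linearly independent, $G=(B(h_i,h_j))_{i,j}$, and let $v\in\mathbb{C}^{2r}$. For $\tau\in\mathbb{H}$, $z\in\mathbb{C}^n$ put $q=e^{2\pi i\tau}$, $\zeta_j=e^{2\pi i z_j}$, $$\theta_h(Q,v,k,\tau,z)=\sum_{m\in\mathbb{Z}^{2r}}B(v,m)^k q^{Q(m)}\zeta_1^{B(m,h_1)}\cdots\zeta_n^{B(m,h_n)},$$ $$\Psi_h(Q,v,k,\tau,z)=\sum_{t=0}^{\lfloor k/2\rfloor}\delta(t,k)\,(2Q(v)E_2(\tau))^t\,\theta_h(Q,v,k-2t,\tau,z),\qquad \delta(t,k)=\frac{k!}{2^t\,t!\,(k-2t)!},$$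 where $E_2(\tau)=-\frac1{12}+2\sum_{m\ge1}\sigma_1(m)q^m$ is the weight $2$ Eisenstein series, normalized so that $(c\tau+d)^{-2}E_2\left(\frac{a\tau+b}{c\tau+d}\right)=E_2(\tau)-\frac{c}{2\pi i(c\tau+d)}$ for $\begin{pmatrix}a&b\\c&d\end{pmatrix}\in SL_2(\mathbb{Z})$. Let $\epsilon(d)=\left(\frac{(-1)^r\det A}{d}\right)$ (Kronecker symbol) for $d>0$, $\epsilon(-d)=(-1)^r\epsilon(d)$, and, when $N=1$, $\epsilon(0)=1$. For a symmetric matrix $F$ write $F[x]=x^TFx$. A holomorphic function $\phi:\mathbb{H}\times\mathbb{C}^n\to\mathbb{C}$ is a Jacobi form of weight $w$, index $F$ (a real symmetric positive definite $n\times n$ matrix) and character $\chi:\Gamma_0(N)\to\mathbb{C}^*$ on $J_0^n(N)=\Gamma_0(N)\ltimes(\mathbb{Z}^n\times\mathbb{Z}^n)$ if it has an expansion $\phi(\tau,z)=\sum c(\ell,\nu)q^\ell e^{2\pi i z^T\nu}$ over $\nu\in\mathbb{Z}^n$ and $\ell\in\mathbb{Q}$ with $\ell\ge0$ and $4\ell-F^{-1}[\nu]\ge0$,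 and if for all $\gamma=\begin{pmatrix}a&b\\c&d\end{pmatrix}\in\Gamma_0(N)$ and $\lambda,\mu\in\mathbb{Z}^n$ $$\phi\left(\tfrac{a\tau+b}{c\tau+d},\tfrac{z}{c\tau+d}\right)=\chi(\gamma)(c\tau+d)^w e^{2\pi i cF[z]/(c\tau+d)}\phi(\tau,z),\qquad \phi(\tau,z+\lambda\tau+\mu)=e^{-2\pi i(\tau F[\lambda]+2z^TF\lambda)}\phi(\tau,z).$$ Theorem. Suppose $B(v,h_j)=0$ for all $1\le j\le n$. Then the series $\theta_h(Q,v,l,\tau,z)$ ($l\ge0$) converge absolutely on $\mathbb{H}\times\mathbb{C}^n$, and for all $\gamma=\begin{pmatrix}a&b\\c&d\end{pmatrix}\in\Gamma_0(N)$, $\lambda,\mu\in\mathbb{Z}^n$ and $(\tau,z)\in\mathbb{H}\times\mathbb{C}^n$, $$\Psi_h\left(Q,v,k,\tfrac{a\tau+b}{c\tau+d},\tfrac{z}{c\tau+d}\right)=\epsilon(d)(c\tau+d)^{k+r}\exp\left(\frac{\pi i c\,G[z]}{c\tau+d}\right)\Psi_h(Q,v,k,\tau,z),$$ $$\Psi_h(Q,v,k,\tau,z+\lambda\tau+\mu)=\exp\left(-\pi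 i(G[\lambda]\tau+2z^TG\lambda)\right)\Psi_h(Q,v,k,\tau,z).$$ In particular, $\gamma\mapsto\epsilon(d)$ is a character of $\Gamma_0(N)$, and $\Psi_h(Q,v,k,\tau,z)$ is a Jacobi form of weight $k+r$, index $G/2$ and character $\epsilon$ on $J_0^n(N)$. -/

import Mathlib

open UpperHalfPlane hiding I
open Complex
open scoped Real MatrixGroups Matrix Nat NumberTheorySymbols

noncomputable section

namespace JacobiTheta

/-! ### Integral quadratic forms -/

/-- The matrix `A` of an integral quadratic form `Q` on `ℤ^f`: its entries are `B(e_i, e_j)`, where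
`B(x, y) = Q(x + y) - Q(x) - Q(y)`, so that `B(x, y) = xᵀ A y` and `2 Q(x) = B(x, x) = xᵀ A x`. -/
def gram {f : ℕ} (Q : QuadraticForm ℤ (Fin f → ℤ)) : Matrix (Fin f) (Fin f) ℤ :=
  Matrix.of fun i j => QuadraticMap.polar Q (Pi.single i 1) (Pi.single j 1)

/-- The complex bilinear extension `B(x, y) = xᵀ A y` of `B` to `ℂ^f` (no conjugation). -/
def bilinC {f : ℕ} (Q : QuadraticForm ℤ (Fin f → ℤ)) (x y : Fin f → ℂ) : ℂ :=
  x ⬝ᵥ ((gram Q).map (Int.cast : ℤ → ℂ)) *ᵥ y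

/-- The extension of `Q` to `ℂ^f`, `2 Q(x) = B(x, x)`. -/
def quadC {f : ℕ} (Q : QuadraticForm ℤ (Fin f → ℤ)) (x : Fin f → ℂ) : ℂ :=
  bilinC Q x x / 2

/-- A vector of `ℤ^f`, viewed in `ℂ^f`. -/
def vecC {f : ℕ} (m : Fin f → ℤ) : Fin f → ℂ := fun i => (m i : ℂ)

/-- `N` is the level of `Q`: the least positive integer such that `M = N A⁻¹` has integral entries
and even diagonal entries. -/
def IsLevel {f : ℕ} (Q : QuadraticForm ℤ (Fin f → ℤ)) (N : ℕ) : Prop :=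
  IsLeast {N : ℕ | 0 < N ∧ ∃ M : Matrix (Fin f) (Fin f) ℤ,
    gram Q * M = (N : ℤ) • (1 : Matrix (Fin f) (Fin f) ℤ) ∧ ∀ i, Even (M i i)} N

/-- The matrix `G` with entries `B(h_i, h_j)`. -/
def gramOf {f n : ℕ} (Q : QuadraticForm ℤ (Fin f → ℤ)) (h : Fin n → Fin f → ℤ) :
    Matrix (Fin n) (Fin n) ℤ :=
  Matrix.of fun i j => QuadraticMap.polar Q (h i) (h j)

/-! ### The character -/

/-- The Kronecker symbol `(a / d)` for a natural number `d`: multiplicative in `d`, equal to the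
Jacobi symbol for odd `d`, with `(a / 2)` equal to `0` for even `a`, to `1` for `a ≡ ±1 mod 8` and
to `-1` for `a ≡ ±3 mod 8`, and with `(a / 0)` equal to `1` if `a = ±1` and `0` otherwise. -/
def kroneckerNat (a : ℤ) (d : ℕ) : ℤ :=
  if d = 0 then (if a.natAbs = 1 then 1 else 0)
  else ZMod.χ₈ (a : ZMod 8) ^ (d.factorization 2) * J(a | d / 2 ^ d.factorization 2)

/-- `ε(d) = ((-1)^r det A / d)` for `d ≥ 0` and `ε(-d) = (-1)^r ε(d)` for `d > 0`. (The value at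
`d = 0` only matters when `A` is unimodular, and then it is `1`.) -/
def eps {r : ℕ} (Q : QuadraticForm ℤ (Fin (2 * r) → ℤ)) (d : ℤ) : ℤ :=
  (if d < 0 then (-1) ^ r else 1) * kroneckerNat ((-1) ^ r * (gram Q).det) d.natAbs

/-! ### The functions -/

/-- The summand of the theta series at `m ∈ ℤ^f`:
`B(v, m)^k q^{Q(m)} ζ_1^{B(m, h_1)} ⋯ ζ_n^{B(m, h_n)}`, `q = e^{2πiτ}`, `ζ_j = e^{2πi z_j}`. -/
def thetaTerm {f n : ℕ} (Q : QuadraticForm ℤ (Fin f → ℤ)) (h : Fin n → Fin f → ℤ)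
    (v : Fin f → ℂ) (k : ℕ) (τ : ℍ) (z : Fin n → ℂ) (m : Fin f → ℤ) : ℂ :=
  bilinC Q v (vecC m) ^ k * cexp (2 * π * I * τ) ^ (Q m) *
    ∏ j, cexp (2 * π * I * z j) ^ (QuadraticMap.polar Q m (h j))

/-- The theta series `θ_h(Q, v, k, τ, z)`. -/
def theta {f n : ℕ} (Q : QuadraticForm ℤ (Fin f → ℤ)) (h : Fin n → Fin f → ℤ)
    (v : Fin f → ℂ) (k : ℕ) (τ : ℍ) (z : Fin n → ℂ) : ℂ :=
  ∑' m : Fin f → ℤ, thetaTerm Q h v k τ z m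

/-- The weight two Eisenstein series with constant term `-B_2/2! = -1/12`:
`E_2(τ) = -1/12 + 2 ∑_{m ≥ 1} σ_1(m) q^m`. It satisfies
`(cτ + d)^{-2} E_2(γτ) = E_2(τ) - c / (2πi (cτ + d))`. (Mathlib's has constant term `1`.) -/
def eisTwo (τ : ℍ) : ℂ := -(1 / 12) * EisensteinSeries.E2 τ

/-- `δ(t, k) = k! / (2^t t! (k - 2t)!)`, used for `2t ≤ k` only. -/
def delta (t k : ℕ) : ℂ := (k ! : ℂ) / (2 ^ t * (t ! : ℂ) * ((k - 2 * t)! : ℂ))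

/-- `Ψ_h(Q, v, k, τ, z) = ∑_{t=0}^{⌊k/2⌋} δ(t, k) (2 Q(v) E_2(τ))^t θ_h(Q, v, k - 2t, τ, z)`. -/
def Psi {f n : ℕ} (Q : QuadraticForm ℤ (Fin f → ℤ)) (h : Fin n → Fin f → ℤ)
    (v : Fin f → ℂ) (k : ℕ) (τ : ℍ) (z : Fin n → ℂ) : ℂ :=
  ∑ t ∈ Finset.range (k / 2 + 1),
    delta t k * (2 * quadC Q v * eisTwo τ) ^ t * theta Q h v (k - 2 * t) τ z

/-! ### Jacobi forms -/

/-- The factor `cτ + d`. -/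
def autFactor (γ : SL(2, ℤ)) (τ : ℍ) : ℂ := (γ 1 0 : ℂ) * (τ : ℂ) + (γ 1 1 : ℂ)

/-- The complex bilinear form `xᵀ F y` of a real matrix `F`; thus `F[z] = bilinOf F z z`. -/
def bilinOf {n : ℕ} (F : Matrix (Fin n) (Fin n) ℝ) (x y : Fin n → ℂ) : ℂ :=
  x ⬝ᵥ (F.map (Complex.ofReal : ℝ → ℂ)) *ᵥ y

/-- `Φ : ℍ × ℂ^n → ℂ` is a (holomorphic) Jacobi form of weight `k`, index `F` and character `χ` on
the subgroup `Γ'` of `SL(2, ℤ)`, i.e. for the group `Γ' ⋉ (ℤ^n × ℤ^n)`. -/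
structure IsJacobiForm {n : ℕ} (Γ' : Subgroup SL(2, ℤ)) (k : ℤ) (F : Matrix (Fin n) (Fin n) ℝ)
    (χ : Γ' →* ℂˣ) (Φ : ℍ → (Fin n → ℂ) → ℂ) : Prop where
  /-- The index is a real symmetric positive definite matrix. -/
  index_posDef : F.PosDef
  /-- `Φ` is holomorphic on `ℍ × ℂ^n`. -/
  holomorphic : DifferentiableOn ℂ (fun p : ℂ × (Fin n → ℂ) => Φ (ofComplex p.1) p.2)
    {p | 0 < p.1.im}
  /-- `Φ = ∑ c(ℓ, ν) q^ℓ exp(2πi zᵀν)` over `ℓ ∈ ℚ`, `ν ∈ ℤ^n` with `ℓ ≥ 0` and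
  `4ℓ - F⁻¹[ν] ≥ 0`. -/
  expansion : ∃ c : ℚ → (Fin n → ℤ) → ℂ,
    (∀ ℓ ν, c ℓ ν ≠ 0 → 0 ≤ ℓ ∧
      0 ≤ 4 * (ℓ : ℝ) - (fun i => (ν i : ℝ)) ⬝ᵥ F⁻¹ *ᵥ (fun i => (ν i : ℝ))) ∧
    ∀ (τ : ℍ) (z : Fin n → ℂ),
      HasSum (fun p : ℚ × (Fin n → ℤ) =>
        c p.1 p.2 * cexp (2 * π * I * ((p.1 : ℂ) * τ)) * cexp (2 * π * I * (z ⬝ᵥ vecC p.2)))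
        (Φ τ z)
  /-- The transformation law under `Γ'`. -/
  modular : ∀ (γ : Γ') (τ : ℍ) (z : Fin n → ℂ),
    Φ ((γ : SL(2, ℤ)) • τ) (fun j => z j / autFactor γ τ) =
      (χ γ : ℂ) * autFactor γ τ ^ k *
        cexp (2 * π * I * (((γ : SL(2, ℤ)) 1 0 : ℂ) * bilinOf F z z / autFactor γ τ)) * Φ τ z
  /-- The transformation law under `ℤ^n × ℤ^n`. -/
  elliptic : ∀ (lam mu : Fin n → ℤ) (τ : ℍ) (z : Fin n → ℂ),
    Φ τ (fun j => z j + (lam j : ℂ) * τ + (mu j : ℂ)) =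
      cexp (-(2 * π * I *
        ((τ : ℂ) * bilinOf F (vecC lam) (vecC lam) + 2 * bilinOf F z (vecC lam)))) * Φ τ z

end JacobiTheta

end

noncomputable section
namespace JacobiTheta

/-! Everything comes from one function, Θ(τ,w) = ∑_m e(τQ(m) + B(m,w)) on ℍ × ℂ^{2r} (`bigTheta`),
with e(x) = e^{2πix}. For γ ∈ Γ_0(N) it satisfies Θ(γτ, w/(cτ+d)) = ε(d) (cτ+d)^r e(cQ(w)/(cτ+d))
Θ(τ,w) (`hasMult_eps`).

Put w = ∑ z_j h_j + (s/2πi)v. As a power series in s, Θ generates the θ_h(Q,v,l)/l!, and exp(Q(v)E_2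
s²)Θ generates the Ψ_h(Q,v,k)/k! (`hasSum_Psi`). Since v is orthogonal to the h_j, 2Q(w) = G[z] +
2Q(v)(s/2πi)²; the automorphy exponential splits, and its s-part cancels the non-modular term of
E_2. Comparing coefficients of s^k under s ↦ s/(cτ+d) gives the modular law (`Psi_modular`). The
elliptic law is the translation of m by ∑ λ_j h_j, and the support condition is the positivity of Q
on real vectors m + ∑ y_j h_j.

For d > 0 the law of Θ (`bigTheta_smul`) follows by splitting the lattice modulo d, applying Poisson
summation (`poisson_gaussian`) to each class, and going back: the definition of the level makes the
resulting Gauss sums independent of the dual vector. The multiplier is d^{-r} ∑_{g mod d}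
e(bQ(g)/d), which is computed only for d an odd prime (`gaussQ_prime`). Multipliers are
multiplicative and trivial when d = 1, so multiplication by unipotent matrices may change c and d;
Dirichlet's theorem then makes an odd d prime (`hasMult_odd`). An even d forces N odd and D = (-1)^r
det A ≡ 1 mod 4, and is replaced by d + c². Negative d is reached through -γ. As Θ(i,0) ≠ 0,
multipliers are unique, so ε(d) is a character. -/

/-! ### Convergence of Gaussian lattice sums -/

lemma summable_pi_prod {ι α : Type*} [Fintype ι] [DecidableEq ι] {g : α → ℝ} (hg : Summable g)
    (h0 : ∀ a, 0 ≤ g a) : Summable fun m : ι → α => ∏ i, g (m i) := by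
  classical
  refine summable_of_sum_le (c := (∑' a, g a) ^ Fintype.card ι)
    (fun m => Finset.prod_nonneg fun i _ => h0 _) fun s => ?_
  -- A finite set of vectors lies in the box of its coordinate projections, and over a box the sum
  -- factors.
  have hs : s ⊆ Fintype.piFinset fun i => s.image fun m => m i := fun m hm =>
    Fintype.mem_piFinset.2 fun i => Finset.mem_image_of_mem _ hm
  refine (Finset.sum_le_sum_of_subset_of_nonneg hs
    fun m _ _ => Finset.prod_nonneg fun i _ => h0 _).trans ?_
  rw [← Finset.prod_univ_sum]
  refine (Finset.prod_le_prod (fun i _ => Finset.sum_nonneg fun a _ => h0 a)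
    fun i _ => hg.sum_le_tsum _ fun a _ => h0 a).trans ?_
  simp

lemma summable_exp_neg_sq_add_abs {c : ℝ} (hc : 0 < c) (R : ℝ) :
    Summable fun m : ℤ => Real.exp (-c * (m : ℝ) ^ 2 + R * |(m : ℝ)|) := by
  have h := summable_pow_mul_jacobiTheta₂_term_bound (R / (2 * π)) (T := c / π) (by positivity) 0
  refine h.congr fun m => ?_
  have := Real.pi_pos
  simp only [pow_zero, one_mul, Int.cast_abs]
  congr 1
  field_simp
  ring

lemma summable_exp_neg_norm_sq {n : ℕ} {c : ℝ} (hc : 0 < c) (R : ℝ) :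
    Summable fun m : Fin n → ℤ => Real.exp (-c * ‖m‖ ^ 2 + R * ‖m‖) := by
  rcases Nat.eq_zero_or_pos n with rfl | hn
  · exact Summable.of_finite
  have hn' : (0 : ℝ) < n := by exact_mod_cast hn
  -- For the sup norm, ∑ m_i² ≤ n‖m‖² and ‖m‖ ≤ ∑ |m_i|: hence c / n, and |R| because R may be
  -- negative.
  have hs := summable_pi_prod (ι := Fin n)
    (summable_exp_neg_sq_add_abs (c := c / n) (by positivity) |R|) fun _ => (Real.exp_pos _).le
  refine hs.of_nonneg_of_le (fun m => (Real.exp_pos _).le) fun m => ?_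
  rw [← Real.exp_sum, Real.exp_le_exp, Finset.sum_add_distrib, ← Finset.mul_sum, ← Finset.mul_sum]
  have h1 : ∑ i, (m i : ℝ) ^ 2 ≤ n * ‖m‖ ^ 2 := by
    have : ∀ i ∈ Finset.univ, (m i : ℝ) ^ 2 ≤ ‖m‖ ^ 2 := fun i _ => by
      have := norm_le_pi_norm m i
      rw [Int.norm_eq_abs] at this
      rw [← sq_abs]
      gcongr
    simpa using Finset.sum_le_sum this
  have h2 : ‖m‖ ≤ ∑ i, |(m i : ℝ)| := by
    refine (pi_norm_le_iff_of_nonneg (Finset.sum_nonneg fun i _ => abs_nonneg _)).2 fun i => ?_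
    rw [Int.norm_eq_abs]
    exact Finset.single_le_sum (f := fun i => |(m i : ℝ)|) (fun i _ => abs_nonneg _)
      (Finset.mem_univ i)
  have h3 : R * ‖m‖ ≤ |R| * ∑ i, |(m i : ℝ)| :=
    (mul_le_mul_of_nonneg_right (le_abs_self R) (norm_nonneg _)).trans
      (mul_le_mul_of_nonneg_left h2 (abs_nonneg _))
  have h4 : c / n * ∑ i, (m i : ℝ) ^ 2 ≤ c * ‖m‖ ^ 2 := by
    calc _ ≤ c / n * (n * ‖m‖ ^ 2) := by gcongr
      _ = _ := by field_simp
  linarith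

/-- The complex quadratic form `xᵀ A x` of a real matrix `A`. -/
def qf {n : ℕ} (A : Matrix (Fin n) (Fin n) ℝ) (x : Fin n → ℂ) : ℂ :=
  x ⬝ᵥ (A.map (Complex.ofReal : ℝ → ℂ)) *ᵥ x

lemma qf_ofReal {n : ℕ} (A : Matrix (Fin n) (Fin n) ℝ) (x : Fin n → ℝ) :
    qf A (fun i => (x i : ℂ)) = ((x ⬝ᵥ A *ᵥ x : ℝ) : ℂ) := by
  simp [qf, dotProduct, Matrix.mulVec]

lemma qf_vecC {n : ℕ} (A : Matrix (Fin n) (Fin n) ℝ) (m : Fin n → ℤ) :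
    qf A (vecC m) = (((fun i => (m i : ℝ)) ⬝ᵥ A *ᵥ (fun i => (m i : ℝ)) : ℝ) : ℂ) := by
  rw [← qf_ofReal]; simp only [ofReal_intCast]; rfl

/-- The constant is the minimum of the form on the compact unit sphere, which is empty only for n =
0. -/
lemma exists_posDef_bound {n : ℕ} {A : Matrix (Fin n) (Fin n) ℝ} (hA : A.PosDef) :
    ∃ c : ℝ, 0 < c ∧ ∀ x : Fin n → ℝ, c * ‖x‖ ^ 2 ≤ x ⬝ᵥ A *ᵥ x := by
  have hpos : ∀ x : Fin n → ℝ, x ≠ 0 → 0 < x ⬝ᵥ A *ᵥ x := fun x hx => by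
    simpa using hA.dotProduct_mulVec_pos hx
  have hcont : Continuous fun x : Fin n → ℝ => x ⬝ᵥ A *ᵥ x := by
    simp only [dotProduct, Matrix.mulVec]; fun_prop
  rcases (Metric.sphere (0 : Fin n → ℝ) 1).eq_empty_or_nonempty with he | hne
  · refine ⟨1, one_pos, fun x => ?_⟩
    by_cases hx : x = 0
    · simp [hx]
    · exfalso
      have : ‖x‖⁻¹ • x ∈ Metric.sphere (0 : Fin n → ℝ) 1 := by
        simp [norm_smul, hx]
      simp [he] at this
  · obtain ⟨x₀, hx₀, hmin⟩ := (isCompact_sphere (0 : Fin n → ℝ) 1).exists_isMinOn hne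
      hcont.continuousOn
    have hx₀' : x₀ ≠ 0 := by
      rintro rfl
      simp at hx₀
    refine ⟨_, hpos x₀ hx₀', fun x => ?_⟩
    by_cases hx : x = 0
    · simp [hx]
    · have hx' : 0 < ‖x‖ := norm_pos_iff.2 hx
      have h1 : ‖x‖⁻¹ • x ∈ Metric.sphere (0 : Fin n → ℝ) 1 := by
        simp [norm_smul, hx]
      have h2 := hmin h1
      simp only [Set.mem_ofPred_eq, Matrix.mulVec_smul, dotProduct_smul, smul_dotProduct,
        smul_eq_mul] at h2
      have h3 := mul_le_mul_of_nonneg_right h2 (sq_nonneg ‖x‖)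
      calc _ ≤ _ := h3
        _ = _ := by field_simp

lemma norm_intCast_vec {n : ℕ} (m : Fin n → ℤ) : ‖fun i => (m i : ℝ)‖ = ‖m‖ := rfl

lemma norm_vecC {n : ℕ} (m : Fin n → ℤ) : ‖vecC m‖ = ‖m‖ := by
  simp [vecC, Pi.norm_def]

lemma norm_dotProduct_le {n : ℕ} (x y : Fin n → ℂ) : ‖x ⬝ᵥ y‖ ≤ n * (‖x‖ * ‖y‖) := by
  refine (norm_sum_le _ _).trans ?_
  have : ∀ i ∈ Finset.univ, ‖x i * y i‖ ≤ ‖x‖ * ‖y‖ := fun i _ => by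
    rw [norm_mul]
    exact mul_le_mul (norm_le_pi_norm x i) (norm_le_pi_norm y i) (norm_nonneg _) (norm_nonneg _)
  simpa using Finset.sum_le_sum this

lemma norm_theta_term_le {n : ℕ} {A : Matrix (Fin n) (Fin n) ℝ} {c : ℝ}
    (hA : ∀ x : Fin n → ℝ, c * ‖x‖ ^ 2 ≤ x ⬝ᵥ A *ᵥ x) {τ : ℂ} (hτ : 0 ≤ τ.im) (u : Fin n → ℂ)
    (m : Fin n → ℤ) :
    ‖cexp (π * I * τ * qf A (vecC m) + 2 * π * I * (vecC m ⬝ᵥ u))‖ ≤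
      Real.exp (-(π * τ.im * c) * ‖m‖ ^ 2 + (2 * π * n * ‖u‖) * ‖m‖) := by
  rw [Complex.norm_exp, Real.exp_le_exp, Complex.add_re]
  have h1 : (π * I * τ * qf A (vecC m)).re ≤ -(π * τ.im * c) * ‖m‖ ^ 2 := by
    rw [qf_vecC]
    have : (π * I * τ * (((fun i => (m i : ℝ)) ⬝ᵥ A *ᵥ (fun i => (m i : ℝ)) : ℝ) : ℂ)).re =
        -(π * τ.im) * ((fun i => (m i : ℝ)) ⬝ᵥ A *ᵥ (fun i => (m i : ℝ))) := by
      simp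
    rw [this]
    have := mul_le_mul_of_nonneg_left (hA fun i => (m i : ℝ)) (mul_nonneg Real.pi_pos.le hτ)
    rw [norm_intCast_vec] at this
    linarith
  have h2 : (2 * π * I * (vecC m ⬝ᵥ u)).re ≤ (2 * π * n * ‖u‖) * ‖m‖ := by
    refine (Complex.re_le_norm _).trans ?_
    rw [norm_mul]
    have := norm_dotProduct_le (vecC m) u
    rw [norm_vecC] at this
    have h3 : ‖(2 * π * I : ℂ)‖ = 2 * π := by simp [Real.pi_pos.le]
    rw [h3]
    calc _ ≤ 2 * π * (n * (‖m‖ * ‖u‖)) := by gcongr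
      _ = _ := by ring
  linarith

lemma summable_theta_term {n : ℕ} {A : Matrix (Fin n) (Fin n) ℝ} (hA : A.PosDef) {τ : ℂ}
    (hτ : 0 < τ.im) (u : Fin n → ℂ) :
    Summable fun m : Fin n → ℤ =>
      cexp (π * I * τ * qf A (vecC m) + 2 * π * I * (vecC m ⬝ᵥ u)) := by
  obtain ⟨c, hc, h⟩ := exists_posDef_bound hA
  have := Real.pi_pos
  exact (summable_exp_neg_norm_sq (c := π * τ.im * c) (by positivity) _).of_norm_bounded
    (norm_theta_term_le h hτ.le u)

/-! ### Splitting off one variable of a quadratic form -/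

/-- The Schur complement of the upper left entry. -/
def schur {n : ℕ} (A : Matrix (Fin (n + 1)) (Fin (n + 1)) ℝ) : Matrix (Fin n) (Fin n) ℝ :=
  Matrix.of fun i j => A i.succ j.succ - A i.succ 0 * A 0 j.succ / A 0 0

/-- The first row without its first entry, as a complex vector. -/
def rowTail {n : ℕ} (A : Matrix (Fin (n + 1)) (Fin (n + 1)) ℝ) : Fin n → ℂ :=
  fun j => (A 0 j.succ : ℂ)

lemma map_schur_mulVec {n : ℕ} {A : Matrix (Fin (n + 1)) (Fin (n + 1)) ℝ} (hs : A.IsSymm)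
    (x : Fin n → ℂ) (i : Fin n) :
    ((schur A).map (Complex.ofReal : ℝ → ℂ) *ᵥ x) i =
      (∑ j, (A i.succ j.succ : ℂ) * x j) - rowTail A i * (rowTail A ⬝ᵥ x) / A 0 0 := by
  have : A i.succ 0 = A 0 i.succ := hs.apply _ _
  simp only [Matrix.mulVec, dotProduct, schur, Matrix.map_apply, Matrix.of_apply, rowTail,
    Complex.ofReal_sub, Complex.ofReal_div, Complex.ofReal_mul, sub_mul, Finset.sum_sub_distrib,
    Finset.mul_sum, Finset.sum_div, this]
  congr 1
  exact Finset.sum_congr rfl fun j _ => by ring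

lemma map_mulVec_cons {n : ℕ} {A : Matrix (Fin (n + 1)) (Fin (n + 1)) ℝ} (hs : A.IsSymm)
    (h0 : A 0 0 ≠ 0) (x₀ : ℂ) (x : Fin n → ℂ) :
    A.map (Complex.ofReal : ℝ → ℂ) *ᵥ (Fin.cons x₀ x : Fin (n + 1) → ℂ) =
      (Fin.cons (A 0 0 * x₀ + rowTail A ⬝ᵥ x) ((schur A).map (Complex.ofReal : ℝ → ℂ) *ᵥ x +
        (x₀ + rowTail A ⬝ᵥ x / A 0 0) • rowTail A) : Fin (n + 1) → ℂ) := by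
  have h0' : (A 0 0 : ℂ) ≠ 0 := by exact_mod_cast h0
  ext i
  refine Fin.cases ?_ (fun i => ?_) i
  · simp [Matrix.mulVec, dotProduct, Fin.sum_univ_succ, rowTail]
  · have : A i.succ 0 = A 0 i.succ := hs.apply _ _
    rw [Fin.cons_succ, Pi.add_apply, map_schur_mulVec hs]
    simp only [Matrix.mulVec, dotProduct, Fin.sum_univ_succ, rowTail, Matrix.map_apply,
      Fin.cons_zero, Fin.cons_succ, this, Pi.smul_apply, smul_eq_mul]
    field_simp
    ring

/-- Completing the square in the first variable. -/
lemma qf_cons {n : ℕ} {A : Matrix (Fin (n + 1)) (Fin (n + 1)) ℝ} (hs : A.IsSymm)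
    (h0 : A 0 0 ≠ 0) (x₀ : ℂ) (x : Fin n → ℂ) :
    qf A (Fin.cons x₀ x : Fin (n + 1) → ℂ) =
      A 0 0 * (x₀ + rowTail A ⬝ᵥ x / A 0 0) ^ 2 + qf (schur A) x := by
  have h0' : (A 0 0 : ℂ) ≠ 0 := by exact_mod_cast h0
  have hd : ∀ (a : ℂ) (v : Fin n → ℂ), (Fin.cons x₀ x : Fin (n + 1) → ℂ) ⬝ᵥ
      (Fin.cons a v : Fin (n + 1) → ℂ) = x₀ * a + x ⬝ᵥ v := fun a v => by
    simp [dotProduct, Fin.sum_univ_succ]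
  rw [qf, map_mulVec_cons hs h0, hd, dotProduct_add, dotProduct_smul, smul_eq_mul,
    dotProduct_comm x (rowTail A), qf]
  field_simp
  ring

lemma posDef_apply_zero_pos {n : ℕ} {A : Matrix (Fin (n + 1)) (Fin (n + 1)) ℝ} (hA : A.PosDef) :
    0 < A 0 0 := hA.diag_pos

lemma posDef_isSymm {n : ℕ} {A : Matrix (Fin n) (Fin n) ℝ} (hA : A.PosDef) : A.IsSymm := by
  have := hA.isHermitian
  rwa [Matrix.IsHermitian, Matrix.conjTranspose_eq_transpose_of_trivial] at this

lemma posDef_of_pos {n : ℕ} {A : Matrix (Fin n) (Fin n) ℝ} (hs : A.IsSymm)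
    (h : ∀ x : Fin n → ℝ, x ≠ 0 → 0 < x ⬝ᵥ A *ᵥ x) : A.PosDef := by
  refine Matrix.PosDef.of_dotProduct_mulVec_pos ?_ fun x hx => by simpa using h x hx
  rw [Matrix.IsHermitian, Matrix.conjTranspose_eq_transpose_of_trivial]
  exact hs

lemma schur_posDef {n : ℕ} {A : Matrix (Fin (n + 1)) (Fin (n + 1)) ℝ} (hA : A.PosDef) :
    (schur A).PosDef := by
  have h0 := posDef_apply_zero_pos hA
  have h0' : (A 0 0 : ℂ) ≠ 0 := by exact_mod_cast h0.ne'
  have hs := posDef_isSymm hA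
  refine posDef_of_pos ?_ fun x hx => ?_
  · ext i j
    simp only [schur, Matrix.transpose_apply, Matrix.of_apply]
    rw [hs.apply i.succ j.succ, hs.apply 0 j.succ, hs.apply i.succ 0]
    ring
  -- This x₀ makes the completed square vanish, so the full form at (x₀, x) equals the Schur
  -- complement at x.
  · set x₀ : ℝ := -((fun j => A 0 j.succ) ⬝ᵥ x) / A 0 0
    have hne : (Fin.cons x₀ x : Fin (n + 1) → ℝ) ≠ 0 := fun he => hx <| by
      ext j; simpa using congrFun he j.succ
    have hp : 0 < (Fin.cons x₀ x : Fin (n + 1) → ℝ) ⬝ᵥ A *ᵥ (Fin.cons x₀ x) := by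
      simpa using hA.dotProduct_mulVec_pos hne
    have h1 := qf_cons hs h0.ne' (x₀ : ℂ) (fun j => (x j : ℂ))
    have h2 : (Fin.cons (x₀ : ℂ) (fun j => (x j : ℂ)) : Fin (n + 1) → ℂ) =
        fun j => ((Fin.cons x₀ x : Fin (n + 1) → ℝ) j : ℂ) := by
      ext j; refine Fin.cases ?_ (fun j => ?_) j <;> simp
    have h3 : (x₀ : ℂ) + rowTail A ⬝ᵥ (fun j => (x j : ℂ)) / A 0 0 = 0 := by
      have : rowTail A ⬝ᵥ (fun j => (x j : ℂ)) = (((fun j => A 0 j.succ) ⬝ᵥ x : ℝ) : ℂ) := by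
        simp [rowTail, dotProduct]
      rw [this]
      simp only [x₀]
      push_cast
      ring
    rw [h2, qf_ofReal, qf_ofReal, h3] at h1
    simp only [ne_eq, OfNat.ofNat_ne_zero, not_false_eq_true, zero_pow, mul_zero, zero_add,
      Complex.ofReal_inj] at h1
    rwa [h1] at hp

lemma isUnit_det_map {n : ℕ} {A : Matrix (Fin n) (Fin n) ℝ} (hA : A.PosDef) :
    IsUnit (A.map (Complex.ofReal : ℝ → ℂ)).det := by
  have := RingHom.map_det Complex.ofRealHom A
  rw [show A.map (Complex.ofReal : ℝ → ℂ) = Complex.ofRealHom.mapMatrix A from rfl, ← this]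
  exact (isUnit_iff_ne_zero.2 hA.det_pos.ne').map _

lemma inv_map {n : ℕ} {A : Matrix (Fin n) (Fin n) ℝ} (hA : A.PosDef) :
    A⁻¹.map (Complex.ofReal : ℝ → ℂ) = (A.map (Complex.ofReal : ℝ → ℂ))⁻¹ := by
  refine (Matrix.inv_eq_left_inv ?_).symm
  have h : A⁻¹ * A = 1 := Matrix.nonsing_inv_mul _ (isUnit_iff_ne_zero.2 hA.det_pos.ne')
  have := congrArg Complex.ofRealHom.mapMatrix h
  rwa [map_mul, map_one] at this

lemma inv_map_mulVec {n : ℕ} {A : Matrix (Fin n) (Fin n) ℝ} (hA : A.PosDef) (x : Fin n → ℂ) :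
    A⁻¹.map (Complex.ofReal : ℝ → ℂ) *ᵥ (A.map (Complex.ofReal : ℝ → ℂ) *ᵥ x) = x := by
  rw [inv_map hA, Matrix.mulVec_mulVec, Matrix.nonsing_inv_mul _ (isUnit_det_map hA),
    Matrix.one_mulVec]

lemma map_mulVec_inv {n : ℕ} {A : Matrix (Fin n) (Fin n) ℝ} (hA : A.PosDef) (x : Fin n → ℂ) :
    A.map (Complex.ofReal : ℝ → ℂ) *ᵥ (A⁻¹.map (Complex.ofReal : ℝ → ℂ) *ᵥ x) = x := by
  rw [inv_map hA, Matrix.mulVec_mulVec, Matrix.mul_nonsing_inv _ (isUnit_det_map hA),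
    Matrix.one_mulVec]

lemma qf_inv_mulVec {n : ℕ} {A : Matrix (Fin n) (Fin n) ℝ} (hA : A.PosDef) (x : Fin n → ℂ) :
    qf A⁻¹ (A.map (Complex.ofReal : ℝ → ℂ) *ᵥ x) = qf A x := by
  rw [qf, inv_map_mulVec hA, dotProduct_comm, qf]

/-- The counterpart of `qf_cons` for the dual form, where the roles are exchanged: the first
variable is now unshifted and the others are translated by a multiple of it. This matches Poisson
summation one variable at a time. -/
lemma qf_inv_cons {n : ℕ} {A : Matrix (Fin (n + 1)) (Fin (n + 1)) ℝ} (hA : A.PosDef)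
    (y₀ : ℂ) (y : Fin n → ℂ) :
    qf A⁻¹ (Fin.cons y₀ y : Fin (n + 1) → ℂ) =
      y₀ ^ 2 / A 0 0 + qf (schur A)⁻¹ (y - (y₀ / A 0 0) • rowTail A) := by
  have h0 := posDef_apply_zero_pos hA
  have h0' : (A 0 0 : ℂ) ≠ 0 := by exact_mod_cast h0.ne'
  have hs := posDef_isSymm hA
  have hS := schur_posDef hA
  set x := (schur A)⁻¹.map (Complex.ofReal : ℝ → ℂ) *ᵥ (y - (y₀ / A 0 0) • rowTail A)
  have hx : (schur A).map (Complex.ofReal : ℝ → ℂ) *ᵥ x = y - (y₀ / A 0 0) • rowTail A :=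
    map_mulVec_inv hS _
  have hy : (Fin.cons y₀ y : Fin (n + 1) → ℂ) = A.map (Complex.ofReal : ℝ → ℂ) *ᵥ
      (Fin.cons ((y₀ - rowTail A ⬝ᵥ x) / A 0 0) x : Fin (n + 1) → ℂ) := by
    rw [map_mulVec_cons hs h0.ne', hx]
    congr 1
    · field_simp
      ring
    · rw [← add_div, sub_add_cancel, sub_add_cancel]
  rw [hy, qf_inv_mulVec hA, qf_cons hs h0.ne', ← hx, qf_inv_mulVec hS]
  congr 1
  field_simp
  ring

/-! ### Poisson summation for Gaussians -/

/-- A positive real factor does not change the argument, so no branch of the logarithm is crossed.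
-/
lemma mul_ofReal_cpow_half {α : ℝ} (hα : 0 < α) {τ : ℂ} (hτ : τ ≠ 0) :
    (-I * (τ * α)) ^ (1 / 2 : ℂ) = (α : ℂ) ^ (1 / 2 : ℂ) * (-I * τ) ^ (1 / 2 : ℂ) := by
  have hα' : (α : ℂ) ≠ 0 := by exact_mod_cast hα.ne'
  have h1 : -I * τ ≠ 0 := mul_ne_zero (neg_ne_zero.2 Complex.I_ne_zero) hτ
  rw [show -I * (τ * α) = (α : ℂ) * (-I * τ) by ring, Complex.cpow_def_of_ne_zero hα',
    Complex.cpow_def_of_ne_zero h1, Complex.cpow_def_of_ne_zero (mul_ne_zero hα' h1),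
    Complex.log_ofReal_mul hα h1, Complex.ofReal_log hα.le, ← Complex.exp_add, add_mul]

lemma tsum_prod_swap {α β : Type*} {f : α × β → ℂ} (hf : Summable f) :
    ∑' p, f p = ∑' b, ∑' a, f (a, b) := by
  rw [← (Equiv.prodComm β α).tsum_eq f]
  exact hf.prod_symm.tsum_prod

/-- The functional equation of the Jacobi theta function at ατ, with its prefactor absorbed into a
completed square. -/
lemma tsum_gaussian_int {α : ℝ} (hα : 0 < α) {τ : ℂ} (hτ : τ ≠ 0) (z : ℂ) :
    ∑' m : ℤ, cexp (π * I * τ * (α * (m : ℂ) ^ 2) + 2 * π * I * (m * z)) =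
      (1 / (α : ℂ) ^ (1 / 2 : ℂ)) * (1 / (-I * τ) ^ (1 / 2 : ℂ)) *
        ∑' m : ℤ, cexp (-(π * I * ((m + z) ^ 2 / α) / τ)) := by
  have hα' : (α : ℂ) ≠ 0 := by exact_mod_cast hα.ne'
  have h := jacobiTheta₂_functional_equation z (τ * α)
  rw [mul_ofReal_cpow_half hα hτ, jacobiTheta₂, jacobiTheta₂, mul_assoc, ← tsum_mul_left] at h
  have e : (fun m : ℤ => cexp (π * I * τ * (α * (m : ℂ) ^ 2) + 2 * π * I * (m * z))) =
      fun m => jacobiTheta₂_term m z (τ * α) := by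
    funext m
    rw [jacobiTheta₂_term]
    congr 1
    ring
  rw [e, h, one_div_mul_one_div]
  congr 1
  rw [← (Equiv.neg ℤ).tsum_eq]
  refine tsum_congr fun m => ?_
  rw [jacobiTheta₂_term, ← Complex.exp_add]
  congr 1
  simp only [Equiv.neg_apply]
  push_cast
  field_simp
  ring

lemma neg_inv_im_pos {τ : ℂ} (hτ : 0 < τ.im) : 0 < (-τ⁻¹).im := by
  have hτ0 : τ ≠ 0 := by rintro rfl; simp at hτ
  rw [Complex.neg_im, Complex.inv_im, neg_div, neg_neg]
  exact div_pos hτ (Complex.normSq_pos.2 hτ0)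

lemma summable_gaussian_dual_int {α : ℝ} (hα : 0 < α) {τ : ℂ} (hτ : 0 < τ.im) (z : ℂ) :
    Summable fun m : ℤ => cexp (-(π * I * ((m + z) ^ 2 / α) / τ)) := by
  have hα' : (α : ℂ) ≠ 0 := by exact_mod_cast hα.ne'
  have hτ0 : τ ≠ 0 := by rintro rfl; simp at hτ
  have him : 0 < (-τ⁻¹ * ((α⁻¹ : ℝ) : ℂ)).im := by
    rw [Complex.im_mul_ofReal]
    exact mul_pos (neg_inv_im_pos hτ) (inv_pos.2 hα)
  have h := ((summable_jacobiTheta₂_term_iff (-(z / (α * τ))) _).2 him).mul_left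
    (cexp (-(π * I * (z ^ 2 / α) / τ)))
  refine h.congr fun m => ?_
  rw [jacobiTheta₂_term, ← Complex.exp_add]
  congr 1
  push_cast
  field_simp
  ring

lemma qf_add {n : ℕ} {A : Matrix (Fin n) (Fin n) ℝ} (hs : A.IsSymm) (x y : Fin n → ℂ) :
    qf A (x + y) = qf A x + 2 * (x ⬝ᵥ A.map (Complex.ofReal : ℝ → ℂ) *ᵥ y) + qf A y := by
  have hs' : (A.map (Complex.ofReal : ℝ → ℂ))ᵀ = A.map (Complex.ofReal : ℝ → ℂ) := by
    rw [← Matrix.transpose_map, hs.eq]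
  have : y ⬝ᵥ A.map (Complex.ofReal : ℝ → ℂ) *ᵥ x = x ⬝ᵥ A.map (Complex.ofReal : ℝ → ℂ) *ᵥ y := by
    rw [Matrix.dotProduct_mulVec, ← Matrix.mulVec_transpose, hs', dotProduct_comm]
  simp only [qf, Matrix.mulVec_add, dotProduct_add, add_dotProduct, this]
  ring

lemma summable_theta_dual {n : ℕ} {A : Matrix (Fin n) (Fin n) ℝ} (hA : A.PosDef) {τ : ℂ}
    (hτ : 0 < τ.im) (u : Fin n → ℂ) :
    Summable fun m : Fin n → ℤ => cexp (-(π * I * qf A⁻¹ (vecC m + u) / τ)) := by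
  have hτ0 : τ ≠ 0 := by rintro rfl; simp at hτ
  refine ((summable_theta_term hA.inv (neg_inv_im_pos hτ)
    (-(τ⁻¹ • (A⁻¹.map (Complex.ofReal : ℝ → ℂ) *ᵥ u)))).mul_left
    (cexp (-(π * I * qf A⁻¹ u / τ)))).congr fun m => ?_
  rw [qf_add (posDef_isSymm hA.inv), ← Complex.exp_add, dotProduct_neg, dotProduct_smul,
    smul_eq_mul]
  congr 1
  field_simp
  ring

/-- Poisson summation for Gaussians in `n` variables. -/
theorem poisson_gaussian (n : ℕ) : ∀ {A : Matrix (Fin n) (Fin n) ℝ}, A.PosDef →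
    ∃ K : ℂ, K ≠ 0 ∧ ∀ τ : ℂ, 0 < τ.im → ∀ u : Fin n → ℂ,
      ∑' m : Fin n → ℤ, cexp (π * I * τ * qf A (vecC m) + 2 * π * I * (vecC m ⬝ᵥ u)) =
        K * (1 / (-I * τ) ^ (1 / 2 : ℂ)) ^ n *
          ∑' m : Fin n → ℤ, cexp (-(π * I * qf A⁻¹ (vecC m + u) / τ)) := by
  induction n with
  | zero =>
    intro A _
    refine ⟨1, one_ne_zero, fun τ _ u => ?_⟩
    simp [tsum_fintype, qf]
  | succ n ih =>
    intro A hA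
    have h0 := posDef_apply_zero_pos hA
    have hα : (A 0 0 : ℂ) ≠ 0 := by exact_mod_cast h0.ne'
    have hs := posDef_isSymm hA
    have hS := schur_posDef hA
    obtain ⟨K, hK, hK'⟩ := ih hS
    refine ⟨K * (1 / (A 0 0 : ℂ) ^ (1 / 2 : ℂ)),
      mul_ne_zero hK (one_div_ne_zero (by simp [hα])), fun τ hτ u => ?_⟩
    have hτ0 : τ ≠ 0 := by rintro rfl; simp at hτ
    let e := Fin.consEquiv (fun _ : Fin (n + 1) => ℤ)
    have hcons : ∀ p : ℤ × (Fin n → ℤ), vecC (e p) =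
        (Fin.cons (p.1 : ℂ) (vecC p.2) : Fin (n + 1) → ℂ) := fun p => by
      ext i; refine Fin.cases ?_ (fun i => ?_) i <;> simp [vecC, e]
    have hu : u = (Fin.cons (u 0) (Fin.tail u) : Fin (n + 1) → ℂ) := (Fin.cons_self_tail u).symm
    -- Completing the square couples the first coordinate to the others only through this shift of u
    -- 0.
    let z : (Fin n → ℤ) → ℂ := fun m => u 0 + τ * (rowTail A ⬝ᵥ vecC m)
    let C : (Fin n → ℤ) → ℂ := fun m =>
      cexp (π * I * τ * (qf (schur A) (vecC m) + (rowTail A ⬝ᵥ vecC m) ^ 2 / A 0 0) +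
        2 * π * I * (vecC m ⬝ᵥ Fin.tail u))
    -- The intermediate series, dual in the first variable and original in the others. Its absolute
    -- convergence allows the two iterated summations to be exchanged.
    let T : ℤ × (Fin n → ℤ) → ℂ := fun p =>
      cexp (-(π * I * ((p.1 + u 0) ^ 2 / A 0 0) / τ)) *
        cexp (π * I * τ * qf (schur A) (vecC p.2) +
          2 * π * I * (vecC p.2 ⬝ᵥ (Fin.tail u - ((p.1 + u 0) / A 0 0) • rowTail A)))
    have hT : Summable T := by
      refine (((summable_gaussian_dual_int h0 hτ (u 0)).norm.mul_of_nonneg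
        (summable_theta_term hS hτ (Fin.tail u - (u 0 / A 0 0) • rowTail A)).norm
        (fun _ => norm_nonneg _) fun _ => norm_nonneg _).of_norm_bounded fun p => ?_)
      simp only [T]
      rw [norm_mul]
      refine mul_le_mul_of_nonneg_left (le_of_eq ?_) (norm_nonneg _)
      rw [Complex.norm_exp, Complex.norm_exp]
      congr 1
      have hr : vecC p.2 ⬝ᵥ rowTail A = ((∑ i, (p.2 i : ℝ) * A 0 i.succ : ℝ) : ℂ) := by
        simp [vecC, rowTail, dotProduct]
      -- The integer p.1 enters the second factor only through a phase, so |T| is a product of two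
      -- summable functions.
      have : 2 * π * I * (vecC p.2 ⬝ᵥ (Fin.tail u - ((p.1 + u 0) / A 0 0) • rowTail A)) =
          2 * π * I * (vecC p.2 ⬝ᵥ (Fin.tail u - (u 0 / A 0 0) • rowTail A)) -
            ((2 * π * p.1 / A 0 0 * (∑ i, (p.2 i : ℝ) * A 0 i.succ) : ℝ) : ℂ) * I := by
        rw [dotProduct_sub, dotProduct_sub, dotProduct_smul, dotProduct_smul, hr]
        simp only [smul_eq_mul, Complex.ofReal_mul, Complex.ofReal_div]
        push_cast
        ring
      rw [this, ← add_sub_assoc, Complex.sub_re, Complex.re_ofReal_mul, Complex.I_re, mul_zero,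
        sub_zero]
    have hL : Summable fun p : ℤ × (Fin n → ℤ) =>
        cexp (π * I * τ * qf A (vecC (e p)) + 2 * π * I * (vecC (e p) ⬝ᵥ u)) :=
      (e.summable_iff (f := fun m => cexp (π * I * τ * qf A (vecC m) +
        2 * π * I * (vecC m ⬝ᵥ u)))).2 (summable_theta_term hA hτ u)
    have hR : Summable fun p : ℤ × (Fin n → ℤ) =>
        cexp (-(π * I * qf A⁻¹ (vecC (e p) + u) / τ)) :=
      (e.summable_iff (f := fun m => cexp (-(π * I * qf A⁻¹ (vecC m + u) / τ)))).2
        (summable_theta_dual hA hτ u)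
    rw [← e.tsum_eq, ← e.tsum_eq]
    have hT1 : ∀ m₀ m, T (m₀, m) = cexp (-(π * I * ((m₀ + z m) ^ 2 / A 0 0) / τ)) * C m := by
      intro m₀ m
      simp only [T, C, z]
      rw [← Complex.exp_add, ← Complex.exp_add, dotProduct_sub, dotProduct_smul,
        dotProduct_comm (vecC m) (rowTail A), smul_eq_mul]
      congr 1
      field_simp
      ring
    -- Summing over the first variable first: the one-dimensional formula at z m.
    have e1 : ∑' p : ℤ × (Fin n → ℤ),
        cexp (π * I * τ * qf A (vecC (e p)) + 2 * π * I * (vecC (e p) ⬝ᵥ u)) =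
        (1 / (A 0 0 : ℂ) ^ (1 / 2 : ℂ)) * (1 / (-I * τ) ^ (1 / 2 : ℂ)) * ∑' p, T p := by
      rw [tsum_prod_swap hT, tsum_prod_swap hL, ← tsum_mul_left]
      refine tsum_congr fun m => ?_
      have h1 := tsum_gaussian_int h0 hτ0 (z m)
      simp only [hT1, tsum_mul_right]
      rw [← mul_assoc, ← h1, ← tsum_mul_right]
      refine tsum_congr fun m₀ => ?_
      rw [hcons, qf_cons hs h0.ne', ← Complex.exp_add, hu]
      congr 1
      simp only [dotProduct, Fin.sum_univ_succ, Fin.cons_zero, Fin.cons_succ, Fin.tail_cons, z]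
      field_simp
      ring
    -- Summing over the other variables first: the induction hypothesis for the Schur complement.
    have e2 : ∑' p, T p = K * (1 / (-I * τ) ^ (1 / 2 : ℂ)) ^ n *
        ∑' p, cexp (-(π * I * qf A⁻¹ (vecC (e p) + u) / τ)) := by
      rw [hT.tsum_prod, hR.tsum_prod, ← tsum_mul_left]
      refine tsum_congr fun m₀ => ?_
      simp only [T]
      rw [tsum_mul_left, hK' τ hτ, mul_left_comm, ← tsum_mul_left]
      congr 1
      refine tsum_congr fun m => ?_
      have h2 : vecC (e (m₀, m)) + u =
          (Fin.cons (m₀ + u 0) (vecC m + Fin.tail u) : Fin (n + 1) → ℂ) := by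
        rw [hcons]
        ext i; refine Fin.cases ?_ (fun i => ?_) i <;> simp [Fin.tail]
      rw [h2, qf_inv_cons hA, ← Complex.exp_add, add_sub_assoc]
      congr 1
      field_simp
      ring
    rw [e1, e2, pow_succ]
    ring

/-! ### Integral forms -/

lemma polar_eq {f : ℕ} (Q : QuadraticForm ℤ (Fin f → ℤ)) (x y : Fin f → ℤ) :
    QuadraticMap.polar Q x y = x ⬝ᵥ gram Q *ᵥ y := by
  have h : gram Q = LinearMap.toMatrix₂' ℤ (QuadraticMap.polarBilin Q) := by
    ext i j
    simp [gram, LinearMap.toMatrix₂'_apply]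
  rw [h, ← Matrix.toLinearMap₂'_apply', Matrix.toLinearMap₂'_toMatrix',
    QuadraticMap.polarBilin_apply_apply]

lemma two_mul_apply {f : ℕ} (Q : QuadraticForm ℤ (Fin f → ℤ)) (x : Fin f → ℤ) :
    2 * Q x = x ⬝ᵥ gram Q *ᵥ x := by
  rw [← polar_eq, QuadraticMap.polar_self]
  simp

lemma gram_isSymm {f : ℕ} (Q : QuadraticForm ℤ (Fin f → ℤ)) : (gram Q).IsSymm := by
  ext i j
  simp [gram, QuadraticMap.polar_comm]

lemma apply_add {f : ℕ} (Q : QuadraticForm ℤ (Fin f → ℤ)) (x y : Fin f → ℤ) :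
    Q (x + y) = Q x + Q y + x ⬝ᵥ gram Q *ᵥ y := by
  rw [← polar_eq, QuadraticMap.polar]
  ring

/-- Positivity at integral vectors gives, by rational approximation, only semidefiniteness over ℝ.
Definiteness follows from det G ≠ 0: a singular integral matrix would kill a nonzero integral
vector. -/
lemma posDef_intCast {n : ℕ} {G : Matrix (Fin n) (Fin n) ℤ} (hs : G.IsSymm)
    (hpos : ∀ x : Fin n → ℤ, x ≠ 0 → 0 < x ⬝ᵥ G *ᵥ x) :
    (G.map (Int.cast : ℤ → ℝ)).PosDef := by
  have hherm : (G.map (Int.cast : ℤ → ℝ)).IsHermitian := by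
    rw [Matrix.IsHermitian, Matrix.conjTranspose_eq_transpose_of_trivial, ← Matrix.transpose_map,
      hs.eq]
  have hcont : Continuous fun x : Fin n → ℝ => x ⬝ᵥ G.map (Int.cast : ℤ → ℝ) *ᵥ x := by
    simp only [dotProduct, Matrix.mulVec]; fun_prop
  have hint : ∀ m : Fin n → ℤ,
      0 ≤ (fun i => (m i : ℝ)) ⬝ᵥ G.map (Int.cast : ℤ → ℝ) *ᵥ (fun i => (m i : ℝ)) := fun m => by
    have h1 : (fun i => (m i : ℝ)) ⬝ᵥ G.map (Int.cast : ℤ → ℝ) *ᵥ (fun i => (m i : ℝ)) =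
        ((m ⬝ᵥ G *ᵥ m : ℤ) : ℝ) := by
      simp [dotProduct, Matrix.mulVec]
    rw [h1]
    by_cases hm : m = 0
    · simp [hm]
    · exact_mod_cast (hpos m hm).le
  have hsemi : (G.map (Int.cast : ℤ → ℝ)).PosSemidef := by
    refine Matrix.PosSemidef.of_dotProduct_mulVec_nonneg hherm fun x => ?_
    rw [star_trivial]
    have hlim : Filter.Tendsto (fun k : ℕ => fun i => (⌊(k : ℝ) * x i⌋ : ℝ) / k) Filter.atTop
        (nhds x) := by
      rw [tendsto_pi_nhds]
      intro i
      rw [tendsto_iff_norm_sub_tendsto_zero]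
      refine squeeze_zero' (Filter.Eventually.of_forall fun _ => norm_nonneg _) ?_
        tendsto_one_div_atTop_nhds_zero_nat
      filter_upwards [Filter.eventually_gt_atTop 0] with k hk
      have hk' : (0 : ℝ) < k := by exact_mod_cast hk
      have h1 : (⌊(k : ℝ) * x i⌋ : ℝ) / k - x i = (⌊(k : ℝ) * x i⌋ - k * x i) / k := by
        field_simp
      rw [h1, norm_div, Real.norm_natCast, Real.norm_eq_abs]
      gcongr
      rw [abs_le]
      constructor <;> linarith [Int.floor_le ((k : ℝ) * x i), Int.lt_floor_add_one ((k : ℝ) * x i)]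
    refine ge_of_tendsto' ((hcont.tendsto x).comp hlim) fun k => ?_
    have h2 : (fun i => (⌊(k : ℝ) * x i⌋ : ℝ) / k) =
        (k : ℝ)⁻¹ • fun i => (⌊(k : ℝ) * x i⌋ : ℝ) := by
      ext i; simp [div_eq_inv_mul]
    simp only [Function.comp_apply]
    rw [h2, Matrix.mulVec_smul, dotProduct_smul, smul_dotProduct, smul_eq_mul, smul_eq_mul]
    have := hint fun i => ⌊(k : ℝ) * x i⌋
    positivity
  refine hsemi.posDef_iff_det_ne_zero.2 ?_
  have hdet : G.det ≠ 0 := fun h0 => by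
    obtain ⟨x, hx, hx0⟩ := Matrix.exists_mulVec_eq_zero_iff.2 h0
    have := hpos x hx
    simp [hx0] at this
  have h3 : (G.map (Int.cast : ℤ → ℝ)).det = ((G.det : ℤ) : ℝ) := by
    have := RingHom.map_det (Int.castRingHom ℝ) G
    simpa using this.symm
  rw [h3]
  exact_mod_cast hdet

/-- The real Gram matrix. -/
abbrev gramR {f : ℕ} (Q : QuadraticForm ℤ (Fin f → ℤ)) : Matrix (Fin f) (Fin f) ℝ :=
  (gram Q).map (Int.cast : ℤ → ℝ)

lemma gramR_posDef {f : ℕ} {Q : QuadraticForm ℤ (Fin f → ℤ)} (hQ : Q.PosDef) :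
    (gramR Q).PosDef := by
  refine posDef_intCast (gram_isSymm Q) fun x hx => ?_
  rw [← two_mul_apply]
  linarith [hQ x hx]

lemma map_gramR {f : ℕ} (Q : QuadraticForm ℤ (Fin f → ℤ)) :
    (gramR Q).map (Complex.ofReal : ℝ → ℂ) = (gram Q).map (Int.cast : ℤ → ℂ) := by
  ext i j; simp

lemma qf_gramR {f : ℕ} (Q : QuadraticForm ℤ (Fin f → ℤ)) (x : Fin f → ℂ) :
    qf (gramR Q) x = bilinC Q x x := by
  rw [qf, map_gramR, bilinC]

lemma vecC_dotProduct {f : ℕ} (x y : Fin f → ℤ) : vecC x ⬝ᵥ vecC y = ((x ⬝ᵥ y : ℤ) : ℂ) := by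
  simp [vecC, dotProduct]

lemma map_mulVec_vecC {f : ℕ} (M : Matrix (Fin f) (Fin f) ℤ) (x : Fin f → ℤ) :
    M.map (Int.cast : ℤ → ℂ) *ᵥ vecC x = vecC (M *ᵥ x) := by
  ext i; simp [vecC, dotProduct, Matrix.mulVec]

lemma bilinC_vecC {f : ℕ} (Q : QuadraticForm ℤ (Fin f → ℤ)) (x y : Fin f → ℤ) :
    bilinC Q (vecC x) (vecC y) = (QuadraticMap.polar Q x y : ℤ) := by
  rw [bilinC, map_mulVec_vecC, vecC_dotProduct, polar_eq]

lemma bilinC_vecC_self {f : ℕ} (Q : QuadraticForm ℤ (Fin f → ℤ)) (x : Fin f → ℤ) :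
    bilinC Q (vecC x) (vecC x) = 2 * (Q x : ℂ) := by
  rw [bilinC_vecC, polar_eq, ← two_mul_apply]
  push_cast; rfl

lemma bilinC_comm {f : ℕ} (Q : QuadraticForm ℤ (Fin f → ℤ)) (x y : Fin f → ℂ) :
    bilinC Q x y = bilinC Q y x := by
  have hs' : ((gram Q).map (Int.cast : ℤ → ℂ))ᵀ = (gram Q).map (Int.cast : ℤ → ℂ) := by
    rw [← Matrix.transpose_map, (gram_isSymm Q).eq]
  rw [bilinC, Matrix.dotProduct_mulVec, ← Matrix.mulVec_transpose, hs', dotProduct_comm, bilinC]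

lemma bilinC_add_left {f : ℕ} (Q : QuadraticForm ℤ (Fin f → ℤ)) (x y z : Fin f → ℂ) :
    bilinC Q (x + y) z = bilinC Q x z + bilinC Q y z := by
  simp [bilinC, add_dotProduct]

lemma bilinC_add_right {f : ℕ} (Q : QuadraticForm ℤ (Fin f → ℤ)) (x y z : Fin f → ℂ) :
    bilinC Q x (y + z) = bilinC Q x y + bilinC Q x z := by
  simp [bilinC, Matrix.mulVec_add, dotProduct_add]

lemma bilinC_smul_left {f : ℕ} (Q : QuadraticForm ℤ (Fin f → ℤ)) (a : ℂ) (x z : Fin f → ℂ) :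
    bilinC Q (a • x) z = a * bilinC Q x z := by
  simp [bilinC, smul_dotProduct]

lemma bilinC_smul_right {f : ℕ} (Q : QuadraticForm ℤ (Fin f → ℤ)) (a : ℂ) (x z : Fin f → ℂ) :
    bilinC Q x (a • z) = a * bilinC Q x z := by
  simp [bilinC, Matrix.mulVec_smul, dotProduct_smul]

lemma vecC_add {f : ℕ} (x y : Fin f → ℤ) : vecC (x + y) = vecC x + vecC y := by
  ext i; simp [vecC]

lemma vecC_smul {f : ℕ} (a : ℤ) (x : Fin f → ℤ) : vecC (a • x) = (a : ℂ) • vecC x := by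
  ext i; simp [vecC]

/-- Modulo 2 the off-diagonal terms cancel in pairs under transposition and the diagonal terms
vanish. -/
lemma even_dotProduct_mulVec {f : ℕ} {M : Matrix (Fin f) (Fin f) ℤ} (hs : M.IsSymm)
    (he : ∀ i, Even (M i i)) (x : Fin f → ℤ) : Even (x ⬝ᵥ M *ᵥ x) := by
  rw [even_iff_two_dvd, ← Nat.cast_two (R := ℤ), ← ZMod.intCast_zmod_eq_zero_iff_dvd]
  have h : ((x ⬝ᵥ M *ᵥ x : ℤ) : ZMod 2) =
      ∑ p : Fin f × Fin f, (x p.1 : ZMod 2) * (M p.1 p.2 * x p.2) := by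
    simp [dotProduct, Matrix.mulVec, Finset.mul_sum, Fintype.sum_prod_type]
  rw [h]
  refine Finset.sum_involution (fun p _ => p.swap) (fun p _ => ?_) (fun p _ hp heq => hp ?_)
    (fun p _ => Finset.mem_univ _) (fun p _ => Prod.swap_swap p)
  · rw [Prod.fst_swap, Prod.snd_swap, hs.apply p.1 p.2]
    have : (x p.1 : ZMod 2) * (M p.1 p.2 * x p.2) + x p.2 * (M p.1 p.2 * x p.1) =
        2 * (x p.1 * (M p.1 p.2 * x p.2)) := by ring
    rw [this, show (2 : ZMod 2) = 0 from rfl, zero_mul]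
  · have h1 : p.2 = p.1 := congrArg Prod.fst heq
    obtain ⟨k, hk⟩ := he p.1
    rw [h1, hk]
    push_cast
    rw [← two_mul, show (2 : ZMod 2) = 0 from rfl]
    ring

lemma isSymm_of_mul_eq {f : ℕ} {A M : Matrix (Fin f) (Fin f) ℤ} (hA : A.IsSymm) {N : ℤ}
    (hN : N ≠ 0) (h : A * M = N • (1 : Matrix (Fin f) (Fin f) ℤ)) : M.IsSymm := by
  have h1 : Mᵀ * A = N • (1 : Matrix (Fin f) (Fin f) ℤ) := by
    have := congrArg Matrix.transpose h
    rwa [Matrix.transpose_mul, hA.eq, Matrix.transpose_smul, Matrix.transpose_one] at this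
  -- Both sides equal Mᵀ A M.
  have h2 : N • M = N • Mᵀ := by
    calc N • M = Mᵀ * A * M := by rw [h1]; simp
      _ = N • Mᵀ := by rw [Matrix.mul_assoc, h, Matrix.mul_smul, Matrix.mul_one]
  ext i j
  have := congrFun (congrFun h2 i) j
  simp only [Matrix.smul_apply, smul_eq_mul] at this
  exact (mul_left_cancel₀ hN this).symm

/-! ### Gauss sums -/

/-- `e(x / d)`. -/
def eDiv (d : ℕ) (x : ℤ) : ℂ := cexp (2 * π * I * x / d)

lemma eDiv_eq_stdAddChar (d : ℕ) [NeZero d] (x : ℤ) :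
    eDiv d x = ZMod.stdAddChar (x : ZMod d) := (ZMod.stdAddChar_coe x).symm

lemma eDiv_congr {d : ℕ} [NeZero d] {x y : ℤ} (h : (x : ZMod d) = y) : eDiv d x = eDiv d y := by
  rw [eDiv_eq_stdAddChar, eDiv_eq_stdAddChar, h]

/-- The standard lift of a vector modulo `d`. -/
def liftZ {f d : ℕ} (g : Fin f → ZMod d) : Fin f → ℤ := fun i => (g i).val

lemma liftZ_cast {f d : ℕ} [NeZero d] (g : Fin f → ZMod d) (i : Fin f) :
    ((liftZ g i : ℤ) : ZMod d) = g i := by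
  simp [liftZ]

lemma apply_cast_congr {f : ℕ} (Q : QuadraticForm ℤ (Fin f → ℤ)) {d : ℕ} {x y : Fin f → ℤ}
    (h : ∀ i, (x i : ZMod d) = y i) : ((Q x : ℤ) : ZMod d) = Q y := by
  have : ∀ i, ∃ t : ℤ, y i = x i + d * t := fun i => by
    obtain ⟨t, ht⟩ := (ZMod.intCast_eq_intCast_iff_dvd_sub (x i) (y i) d).1 (h i)
    exact ⟨t, by linarith⟩
  choose t ht using this
  have hy : y = x + (d : ℤ) • t := by ext i; simp [ht]
  rw [hy, apply_add, QuadraticMap.map_smul, Matrix.mulVec_smul, dotProduct_smul]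
  simp

/-- The quadratic Gauss sum `∑_{g mod d} e(b Q(g) / d)`. -/
def gaussQ {f : ℕ} (Q : QuadraticForm ℤ (Fin f → ℤ)) (b : ℤ) (d : ℕ) [NeZero d] : ℂ :=
  ∑ g : Fin f → ZMod d, eDiv d (b * Q (liftZ g))

lemma gaussQ_shift {f : ℕ} (Q : QuadraticForm ℤ (Fin f → ℤ)) (b : ℤ) (d : ℕ) [NeZero d]
    (y : Fin f → ℤ) : ∑ g : Fin f → ZMod d, eDiv d (b * Q (liftZ g + y)) = gaussQ Q b d := by
  refine (Finset.sum_congr rfl fun g _ => eDiv_congr ?_).trans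
    (Equiv.sum_comp (Equiv.addRight (fun i => (y i : ZMod d))) fun g => eDiv d (b * Q (liftZ g)))
  rw [Int.cast_mul, Int.cast_mul, apply_cast_congr Q (y := liftZ
    (Equiv.addRight (fun i => (y i : ZMod d)) g)) fun i => ?_]
  rw [liftZ_cast, Pi.add_apply, Int.cast_add, liftZ_cast]
  rfl

/-- Vectors of `ℤ^f` are a class modulo `d` and a multiple of `d`. -/
def modEquiv (f d : ℕ) [NeZero d] : (Fin f → ZMod d) × (Fin f → ℤ) ≃ (Fin f → ℤ) where
  toFun p := liftZ p.1 + (d : ℤ) • p.2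
  invFun m := (fun i => (m i : ZMod d), fun i => (m i - liftZ (fun i => (m i : ZMod d)) i) / d)
  left_inv p := by
    have hd : (d : ℤ) ≠ 0 := by exact_mod_cast NeZero.ne d
    have h : (fun i => (((liftZ p.1 + (d : ℤ) • p.2) i : ℤ) : ZMod d)) = p.1 := by
      ext i
      rw [Pi.add_apply, Int.cast_add, liftZ_cast]
      simp
    refine Prod.ext h ?_
    funext i
    simp only [h]
    simpa using Int.mul_ediv_cancel_left (p.2 i) hd
  right_inv m := by
    ext i
    have h : (d : ℤ) ∣ m i - liftZ (fun i => (m i : ZMod d)) i := by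
      rw [← ZMod.intCast_zmod_eq_zero_iff_dvd, Int.cast_sub, liftZ_cast, sub_self]
    simp only [Pi.add_apply, Pi.smul_apply, smul_eq_mul]
    rw [Int.mul_ediv_cancel' h]
    ring

/-! ### The theta function on `ℍ × ℂ^f` -/

/-- `Θ(τ, w) = ∑_m e(τ Q(m) + B(m, w))`. -/
def bigTheta {f : ℕ} (Q : QuadraticForm ℤ (Fin f → ℤ)) (τ : ℂ) (w : Fin f → ℂ) : ℂ :=
  ∑' m : Fin f → ℤ, cexp (2 * π * I * (τ * Q m + bilinC Q (vecC m) w))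

lemma bigTheta_term {f : ℕ} (Q : QuadraticForm ℤ (Fin f → ℤ)) (τ : ℂ) (w : Fin f → ℂ)
    (m : Fin f → ℤ) : cexp (2 * π * I * (τ * Q m + bilinC Q (vecC m) w)) =
      cexp (π * I * τ * qf (gramR Q) (vecC m) +
        2 * π * I * (vecC m ⬝ᵥ ((gram Q).map (Int.cast : ℤ → ℂ) *ᵥ w))) := by
  rw [qf_gramR, bilinC_vecC_self, ← bilinC]
  congr 1
  ring

lemma summable_bigTheta {f : ℕ} {Q : QuadraticForm ℤ (Fin f → ℤ)} (hQ : Q.PosDef) {τ : ℂ}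
    (hτ : 0 < τ.im) (w : Fin f → ℂ) : Summable fun m : Fin f → ℤ =>
      cexp (2 * π * I * (τ * Q m + bilinC Q (vecC m) w)) := by
  simp only [bigTheta_term]
  exact summable_theta_term (gramR_posDef hQ) hτ _

lemma bigTheta_neg {f : ℕ} (Q : QuadraticForm ℤ (Fin f → ℤ)) (τ : ℂ) (w : Fin f → ℂ) :
    bigTheta Q τ (-w) = bigTheta Q τ w := by
  rw [bigTheta, ← (Equiv.neg (Fin f → ℤ)).tsum_eq, bigTheta]
  refine tsum_congr fun m => ?_
  have h1 : vecC (-m) = -vecC m := by ext i; simp [vecC]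
  rw [Equiv.neg_apply, QuadraticMap.map_neg, h1]
  simp [bilinC, Matrix.mulVec_neg]

lemma bigTheta_split {f : ℕ} {Q : QuadraticForm ℤ (Fin f → ℤ)} (hQ : Q.PosDef) {τ : ℂ}
    (hτ : 0 < τ.im) (w : Fin f → ℂ) (d : ℕ) [NeZero d] :
    bigTheta Q τ w = ∑ g : Fin f → ZMod d, ∑' m : Fin f → ℤ,
      cexp (2 * π * I * (τ * Q (liftZ g + (d : ℤ) • m) +
        bilinC Q (vecC (liftZ g + (d : ℤ) • m)) w)) := by
  have hs : Summable fun p => cexp (2 * π * I * (τ * Q (modEquiv f d p) +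
      bilinC Q (vecC (modEquiv f d p)) w)) :=
    ((modEquiv f d).summable_iff (f := fun m => cexp (2 * π * I *
      (τ * Q m + bilinC Q (vecC m) w)))).2 (summable_bigTheta hQ hτ w)
  rw [bigTheta, ← (modEquiv f d).tsum_eq, Summable.tsum_prod hs, tsum_fintype]
  rfl

/-- The even rank 2r removes the square roots from Poisson summation, so no choice of branch
survives. -/
lemma cpow_half_pow_two_mul (x : ℂ) (r : ℕ) :
    (1 / x ^ (1 / 2 : ℂ)) ^ (2 * r) = (1 / x) ^ r := by
  rw [pow_mul, div_pow, one_pow, ← Complex.cpow_nat_mul]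
  norm_num

lemma qf_inv_add_mulVec {n : ℕ} {A : Matrix (Fin n) (Fin n) ℝ} (hA : A.PosDef) (x y : Fin n → ℂ) :
    qf A⁻¹ (x + A.map (Complex.ofReal : ℝ → ℂ) *ᵥ y) = qf A⁻¹ x + 2 * (x ⬝ᵥ y) + qf A y := by
  rw [qf_add (posDef_isSymm hA.inv), inv_map_mulVec hA, qf_inv_mulVec hA]

/-- The dual expansion of `Θ`. -/
lemma exists_bigTheta_dual {f : ℕ} {Q : QuadraticForm ℤ (Fin f → ℤ)} (hQ : Q.PosDef) :
    ∃ K : ℂ, K ≠ 0 ∧ ∀ τ : ℂ, 0 < τ.im → ∀ w : Fin f → ℂ, bigTheta Q τ w =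
      K * (1 / (-I * τ) ^ (1 / 2 : ℂ)) ^ f * ∑' m : Fin f → ℤ,
        cexp (-(π * I * (qf (gramR Q)⁻¹ (vecC m) + 2 * (vecC m ⬝ᵥ w) + bilinC Q w w) / τ)) := by
  obtain ⟨K, hK, h⟩ := poisson_gaussian f (gramR_posDef hQ)
  refine ⟨K, hK, fun τ hτ w => ?_⟩
  simp only [bigTheta, bigTheta_term]
  rw [h τ hτ]
  congr 1
  refine tsum_congr fun m => ?_
  rw [← map_gramR, qf_inv_add_mulVec (gramR_posDef hQ), qf_gramR]

/-- `A⁻¹[n] = M[n] / N` when `A M = N`. -/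
lemma qf_inv_of_mul_eq {f : ℕ} {Q : QuadraticForm ℤ (Fin f → ℤ)} (hQ : Q.PosDef)
    {M : Matrix (Fin f) (Fin f) ℤ} {N : ℕ} (hN : N ≠ 0)
    (hM : gram Q * M = (N : ℤ) • (1 : Matrix (Fin f) (Fin f) ℤ)) (n : Fin f → ℤ) :
    qf (gramR Q)⁻¹ (vecC n) = ((n ⬝ᵥ M *ᵥ n : ℤ) : ℂ) / N := by
  have hN' : (N : ℂ) ≠ 0 := by exact_mod_cast hN
  have h1 : vecC n = (gramR Q).map (Complex.ofReal : ℝ → ℂ) *ᵥ ((N : ℂ)⁻¹ • vecC (M *ᵥ n)) := by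
    rw [map_gramR, Matrix.mulVec_smul, map_mulVec_vecC, Matrix.mulVec_mulVec, hM,
      Matrix.smul_mulVec, Matrix.one_mulVec, vecC_smul, smul_smul]
    simp [hN']
  rw [qf]
  nth_rewrite 2 [h1]
  rw [inv_map_mulVec (gramR_posDef hQ), dotProduct_smul, vecC_dotProduct, smul_eq_mul]
  ring

/-- Completing the square in the Gauss sum. -/
lemma sum_eDiv_eq_gaussQ {f : ℕ} {Q : QuadraticForm ℤ (Fin f → ℤ)}
    {M : Matrix (Fin f) (Fin f) ℤ} {N : ℕ}
    (hM : gram Q * M = (N : ℤ) • (1 : Matrix (Fin f) (Fin f) ℤ)) {a b c' : ℤ} {d : ℕ} [NeZero d]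
    (hdet : a * d - b * (N * c') = 1) {n : Fin f → ℤ} {R : ℤ} (hR : c' * (n ⬝ᵥ M *ᵥ n) = 2 * R) :
    ∑ g : Fin f → ZMod d, eDiv d (b * Q (liftZ g) - n ⬝ᵥ liftZ g - R) = gaussQ Q b d := by
  -- For y = c'Mn, Ay = Nc'n and Q(y) = Nc'R. Since bNc' = ad - 1 ≡ -1 mod d, shifting g by y adds
  -- exactly -n·g - R to bQ(g) modulo d.
  rw [← gaussQ_shift Q b d (c' • (M *ᵥ n))]
  refine Finset.sum_congr rfl fun g _ => eDiv_congr ?_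
  have hAy : gram Q *ᵥ (c' • (M *ᵥ n)) = (N * c') • n := by
    rw [Matrix.mulVec_smul, Matrix.mulVec_mulVec, hM, Matrix.smul_mulVec, Matrix.one_mulVec,
      smul_smul, mul_comm]
  have hQy : Q (c' • (M *ᵥ n)) = N * c' * R := by
    have := two_mul_apply Q (c' • (M *ᵥ n))
    rw [hAy, dotProduct_smul, smul_dotProduct, dotProduct_comm, smul_eq_mul, smul_eq_mul, hR] at this
    linarith
  rw [apply_add, hAy, hQy, dotProduct_smul, smul_eq_mul, dotProduct_comm n]
  rw [ZMod.intCast_eq_intCast_iff_dvd_sub]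
  refine ⟨a * (liftZ g ⬝ᵥ n + R), ?_⟩
  linear_combination (-(liftZ g ⬝ᵥ n + R)) * hdet

lemma im_mul_div_pos {τ : ℂ} (hτ : 0 < τ.im) (c : ℤ) {d : ℕ} (hd : d ≠ 0)
    (hj : (c : ℂ) * τ + d ≠ 0) : 0 < (τ * d / (c * τ + d)).im := by
  have hτ0 : τ ≠ 0 := by rintro rfl; simp at hτ
  have hd' : (d : ℂ) ≠ 0 := by exact_mod_cast hd
  have h1 : 0 < (-τ⁻¹ - ((c / d : ℝ) : ℂ)).im := by
    rw [Complex.sub_im, Complex.ofReal_im, sub_zero]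
    exact neg_inv_im_pos hτ
  have h2 := neg_inv_im_pos h1
  -- The point is reached from τ by inversion, a real translation and inversion.
  have h3 : τ * d / (c * τ + d) = -(-τ⁻¹ - ((c / d : ℝ) : ℂ))⁻¹ := by
    rw [eq_comm, neg_eq_iff_eq_neg, inv_eq_iff_eq_inv]
    push_cast
    rw [← neg_div, inv_div]
    field_simp
    ring
  rwa [h3]

/-- The factor e(bQ/d) depends only on the class g modulo d; the rest, expanded in m, is a summand
of Θ at σd². -/
lemma coset_term {f : ℕ} (Q : QuadraticForm ℤ (Fin f → ℤ)) (b : ℤ) (d : ℕ) [NeZero d] (σ : ℂ)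
    (w : Fin f → ℂ) (g m : Fin f → ℤ) :
    cexp (2 * π * I * ((b / d + σ) * Q (g + (d : ℤ) • m) + bilinC Q (vecC (g + (d : ℤ) • m)) w)) =
      eDiv d (b * Q g) * cexp (2 * π * I * (σ * Q g + bilinC Q (vecC g) w)) *
        cexp (2 * π * I * (σ * d ^ 2 * Q m +
          bilinC Q (vecC m) ((d : ℂ) • (σ • vecC g + w)))) := by
  have h1 : eDiv d (b * Q (g + (d : ℤ) • m)) = eDiv d (b * Q g) := by
    refine eDiv_congr ?_
    rw [Int.cast_mul, Int.cast_mul, apply_cast_congr Q (y := g) fun i => ?_]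
    simp
  have h2 : (Q (g + (d : ℤ) • m) : ℂ) = Q g + d ^ 2 * Q m + d * bilinC Q (vecC g) (vecC m) := by
    rw [apply_add, QuadraticMap.map_smul, Matrix.mulVec_smul, dotProduct_smul, bilinC_vecC,
      polar_eq]
    push_cast [smul_eq_mul]
    ring
  rw [← h1, eDiv, ← Complex.exp_add, ← Complex.exp_add, vecC_add, vecC_smul, bilinC_add_left,
    bilinC_smul_left, bilinC_smul_right, bilinC_add_right, bilinC_smul_right,
    bilinC_comm Q (vecC m) (vecC g)]
  congr 1
  have hd' : (d : ℂ) ≠ 0 := by exact_mod_cast NeZero.ne d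
  rw [Int.cast_mul]
  rw [add_mul, h2]
  push_cast
  field_simp
  ring

/-- Each class modulo d gives a Θ-value at dτ/(cτ+d). Its dual expansion is, up to a d-th root of
unity, that of Θ(τ,w), and summing these roots over the classes gives a Gauss sum free of the dual
vector. The constant K of Poisson summation occurs on both sides, so its value is never needed. -/
theorem bigTheta_smul {r : ℕ} {Q : QuadraticForm ℤ (Fin (2 * r) → ℤ)} (hQ : Q.PosDef)
    {M : Matrix (Fin (2 * r)) (Fin (2 * r)) ℤ} {N : ℕ} (hN : N ≠ 0)
    (hM : gram Q * M = (N : ℤ) • (1 : Matrix (Fin (2 * r)) (Fin (2 * r)) ℤ))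
    (hMe : ∀ i, Even (M i i)) {a b c : ℤ} {d : ℕ} [NeZero d] (hc : (N : ℤ) ∣ c)
    (hdet : a * d - b * c = 1) {τ : ℂ} (hτ : 0 < τ.im) (w : Fin (2 * r) → ℂ) :
    bigTheta Q ((a * τ + b) / (c * τ + d)) ((c * τ + d : ℂ)⁻¹ • w) =
      gaussQ Q b d / d ^ r * (c * τ + d) ^ r *
        cexp (π * I * c * bilinC Q w w / (c * τ + d)) * bigTheta Q τ w := by
  have hd : d ≠ 0 := NeZero.ne d
  have hd' : (d : ℂ) ≠ 0 := by exact_mod_cast hd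
  have hN' : (N : ℂ) ≠ 0 := by exact_mod_cast hN
  have hτ0 : τ ≠ 0 := by rintro rfl; simp at hτ
  have hj : (c : ℂ) * τ + d ≠ 0 := fun h => by
    have him := congrArg Complex.im h
    simp only [Complex.add_im, Complex.mul_im, Complex.intCast_re, Complex.intCast_im,
      Complex.natCast_im, Complex.zero_im, zero_mul, add_zero, mul_eq_zero, hτ.ne', or_false] at him
    have hc0 : c = 0 := by exact_mod_cast him
    exact hd' (by simpa [hc0] using h)
  obtain ⟨c', rfl⟩ := hc
  set j : ℂ := ((N * c' : ℤ) : ℂ) * τ + d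
  have hjτ : ((N * c' : ℤ) : ℂ) * τ = j - d := by simp [j]
  obtain ⟨K, hK, hdual⟩ := exists_bigTheta_dual hQ
  have hdetC : (a : ℂ) * d = 1 + b * ((N * c' : ℤ) : ℂ) := by
    have : ((a * d - b * (N * c') : ℤ) : ℂ) = 1 := by rw [hdet]; simp
    push_cast at this ⊢
    linear_combination this
  -- As ad - bc = 1, γτ differs from b/d by τ/(d(cτ+d)).
  set σ : ℂ := τ / (d * j) with hσ
  have hγ : (a * τ + b) / j = b / d + σ := by
    rw [hσ]
    field_simp
    have : τ * (a * d) = τ + b * (((N * c' : ℤ) : ℂ) * τ) := by rw [hdetC]; ring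
    rw [hjτ] at this
    linear_combination this
  have him : 0 < (τ * d / j).im := im_mul_div_pos hτ _ hd hj
  have hσd : σ * d ^ 2 = τ * d / j := by rw [hσ]; field_simp
  have himγ : 0 < (b / d + σ : ℂ).im := by
    have h1 : (b / d + σ : ℂ) = ((b / d : ℝ) : ℂ) + ((1 / d ^ 2 : ℝ) : ℂ) * (τ * d / j) := by
      rw [← hσd]
      push_cast
      field_simp
    rw [h1, Complex.add_im, Complex.ofReal_im, zero_add, Complex.im_ofReal_mul]
    have : (0 : ℝ) < d := by positivity
    positivity
  -- The even diagonal in the definition of the level is what makes c'M[n]/2 an integer.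
  have hR : ∀ n : Fin (2 * r) → ℤ, ∃ R : ℤ, c' * (n ⬝ᵥ M *ᵥ n) = 2 * R := fun n => by
    obtain ⟨k, hk⟩ := even_dotProduct_mulVec
      (isSymm_of_mul_eq (gram_isSymm Q) (by exact_mod_cast hN) hM) hMe n
    exact ⟨c' * k, by rw [hk]; ring⟩
  choose R hR using hR
  rw [hγ, bigTheta_split hQ himγ _ d]
  simp only [coset_term, tsum_mul_left]
  have hbig : ∀ g : Fin (2 * r) → ZMod d, ∑' m : Fin (2 * r) → ℤ,
      cexp (2 * π * I * (σ * d ^ 2 * Q m +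
          bilinC Q (vecC m) ((d : ℂ) • (σ • vecC (liftZ g) + j⁻¹ • w)))) =
      bigTheta Q (τ * d / j) ((d : ℂ) • (σ • vecC (liftZ g) + j⁻¹ • w)) := fun g => by
    rw [hσd]; rfl
  simp only [hbig, hdual _ him]
  have hterm : ∀ (g : Fin (2 * r) → ZMod d) (n : Fin (2 * r) → ℤ),
      eDiv d (b * Q (liftZ g)) *
        cexp (2 * π * I * (σ * Q (liftZ g) + bilinC Q (vecC (liftZ g)) (j⁻¹ • w))) *
        cexp (-(π * I * (qf (gramR Q)⁻¹ (vecC n) +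
          2 * (vecC n ⬝ᵥ ((d : ℂ) • (σ • vecC (liftZ g) + j⁻¹ • w))) +
          bilinC Q ((d : ℂ) • (σ • vecC (liftZ g) + j⁻¹ • w))
            ((d : ℂ) • (σ • vecC (liftZ g) + j⁻¹ • w))) / (τ * d / j))) =
      cexp (π * I * ((N * c' : ℤ) : ℂ) * bilinC Q w w / j) *
        (cexp (-(π * I * (qf (gramR Q)⁻¹ (vecC n) + 2 * (vecC n ⬝ᵥ w) + bilinC Q w w) / τ)) *
        eDiv d (b * Q (liftZ g) - n ⬝ᵥ liftZ g - R n)) := fun g n => by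
    have hX : ((N * c' : ℤ) : ℂ) * qf (gramR Q)⁻¹ (vecC n) = 2 * R n := by
      rw [qf_inv_of_mul_eq hQ hN hM]
      have : ((c' * (n ⬝ᵥ M *ᵥ n) : ℤ) : ℂ) = ((2 * R n : ℤ) : ℂ) := by rw [hR]
      push_cast at this ⊢
      field_simp
      linear_combination this
    rw [eDiv, eDiv, ← Complex.exp_add, ← Complex.exp_add, ← Complex.exp_add, ← Complex.exp_add]
    congr 1
    simp only [bilinC_smul_left, bilinC_smul_right, bilinC_add_left, bilinC_add_right,
      dotProduct_smul, dotProduct_add, vecC_dotProduct, smul_eq_mul,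
      bilinC_comm Q w (vecC (liftZ g)), bilinC_vecC_self]
    set X := qf (gramR Q)⁻¹ (vecC n)
    set W := bilinC Q w w
    set G := bilinC Q (vecC (liftZ g)) w
    have hXj : X * j = 2 * R n * τ + X * d := by
      rw [← hX]; simp only [j]; ring
    have hWj : ((N * c' : ℤ) : ℂ) * W * τ = W * (j - d) := by rw [← hjτ]; ring
    push_cast
    push_cast at hWj
    rw [hσ]
    field_simp
    linear_combination (-j) * hXj - d * hWj
  have hD : Summable fun n : Fin (2 * r) → ℤ =>
      cexp (-(π * I * (qf (gramR Q)⁻¹ (vecC n) + 2 * (vecC n ⬝ᵥ w) + bilinC Q w w) / τ)) := by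
    refine (summable_theta_dual (gramR_posDef hQ) hτ
      ((gram Q).map (Int.cast : ℤ → ℂ) *ᵥ w)).congr fun n => ?_
    rw [← map_gramR, qf_inv_add_mulVec (gramR_posDef hQ), qf_gramR]
  have hsum : ∀ g : Fin (2 * r) → ZMod d,
      eDiv d (b * Q (liftZ g)) *
        cexp (2 * π * I * (σ * Q (liftZ g) + bilinC Q (vecC (liftZ g)) (j⁻¹ • w))) *
        (K * (1 / (-I * (τ * d / j)) ^ (1 / 2 : ℂ)) ^ (2 * r) * ∑' n : Fin (2 * r) → ℤ,
          cexp (-(π * I * (qf (gramR Q)⁻¹ (vecC n) +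
            2 * (vecC n ⬝ᵥ ((d : ℂ) • (σ • vecC (liftZ g) + j⁻¹ • w))) +
            bilinC Q ((d : ℂ) • (σ • vecC (liftZ g) + j⁻¹ • w))
              ((d : ℂ) • (σ • vecC (liftZ g) + j⁻¹ • w))) / (τ * d / j)))) =
      K * (1 / (-I * (τ * d / j)) ^ (1 / 2 : ℂ)) ^ (2 * r) *
        (cexp (π * I * ((N * c' : ℤ) : ℂ) * bilinC Q w w / j) * ∑' n : Fin (2 * r) → ℤ,
        cexp (-(π * I * (qf (gramR Q)⁻¹ (vecC n) + 2 * (vecC n ⬝ᵥ w) + bilinC Q w w) / τ)) *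
        eDiv d (b * Q (liftZ g) - n ⬝ᵥ liftZ g - R n)) := fun g => by
    rw [mul_left_comm, ← tsum_mul_left, ← tsum_mul_left]
    simp only [hterm, tsum_mul_left]
  simp only [hsum]
  rw [← Finset.mul_sum, ← Finset.mul_sum, ← Summable.tsum_finsetSum]
  · simp only [← Finset.mul_sum, sum_eDiv_eq_gaussQ hM hdet (hR _), tsum_mul_right]
    rw [hdual τ hτ w, cpow_half_pow_two_mul, cpow_half_pow_two_mul]
    have h1 : (1 / (-I * (τ * d / j)) : ℂ) ^ r = (1 / (-I * τ)) ^ r * (j ^ r / d ^ r) := by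
      rw [← div_pow, ← mul_pow]
      congr 1
      have := Complex.I_ne_zero
      field_simp
    rw [h1]
    ring
  -- The roots of unity have modulus one, so the dual series of Θ(τ,w) dominates.
  · intro g _
    refine hD.norm.of_norm_bounded fun n => ?_
    rw [norm_mul, eDiv]
    have h2 : (2 * π * I * ((b * Q (liftZ g) - n ⬝ᵥ liftZ g - R n : ℤ) : ℂ) / d : ℂ) =
        ((2 * π * ((b * Q (liftZ g) - n ⬝ᵥ liftZ g - R n : ℤ) : ℝ) / d : ℝ) : ℂ) * I := by
      push_cast
      ring
    rw [h2, Complex.norm_exp_ofReal_mul_I, mul_one]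

/-! ### Evaluation of the Gauss sum at a prime -/

lemma map_sum_addChar {F : Type*} [Field F] (ψ : AddChar F ℂ) {n : ℕ} (x : Fin n → F) :
    ψ (∑ i, x i) = ∏ i, ψ (x i) := by
  exact map_prod ψ.toMonoidHom (fun i => Multiplicative.ofAdd (x i)) Finset.univ

lemma discr'_toQuadraticMap {F : Type*} [Field F] {n : ℕ} [Invertible (2 : F)] {S : Matrix (Fin n) (Fin n) F}
    (hS : S.IsSymm) : QuadraticForm.discr'
      (LinearMap.BilinMap.toQuadraticMap (Matrix.toLinearMap₂' F S)) = S.det := by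
  rw [QuadraticForm.discr', QuadraticForm.toMatrix', QuadraticMap.associated_left_inverse,
    LinearMap.toMatrix'_toLinearMap₂']
  intro x y
  rw [Matrix.toLinearMap₂'_apply', Matrix.toLinearMap₂'_apply', Matrix.dotProduct_mulVec,
    ← Matrix.mulVec_transpose, hS.eq, dotProduct_comm]

section GaussPrime

variable {F : Type*} [Field F] [Fintype F] [DecidableEq F]

/-- The complex-valued quadratic character. -/
def quadCharC (F : Type*) [Field F] [Fintype F] [DecidableEq F] : MulChar F ℂ :=
  (quadraticChar F).ringHomComp (Int.castRingHom ℂ)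

lemma quadCharC_apply (a : F) : quadCharC F a = (quadraticChar F a : ℂ) := rfl

/-- An element t has 1 + χ(t) square roots; the constant 1 contributes a full character sum, which
is zero. -/
lemma sum_addChar_mul_sq (hF : ringChar F ≠ 2) {ψ : AddChar F ℂ} (hψ : ψ.IsPrimitive) {a : F}
    (ha : a ≠ 0) : ∑ x : F, ψ (a * x ^ 2) = quadCharC F a * gaussSum (quadCharC F) ψ := by
  have h1 : ∑ x : F, ψ (a * x ^ 2) = ∑ t : F, ((quadraticChar F t : ℂ) + 1) * ψ (a * t) := by
    rw [← Finset.sum_fiberwise (s := Finset.univ) (g := fun x : F => x ^ 2)]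
    refine Finset.sum_congr rfl fun t _ => ?_
    have h2 := quadraticChar_card_sqrts hF t
    rw [Finset.sum_congr rfl (g := fun _ => ψ (a * t)) fun x hx => by
      rw [(Finset.mem_filter.1 hx).2], Finset.sum_const, nsmul_eq_mul]
    congr 1
    have h3 : ((Finset.univ.filter fun x : F => x ^ 2 = t).card : ℤ) = quadraticChar F t + 1 := by
      rw [← h2]
      congr 2
      ext x
      simp
    exact_mod_cast h3
  have h4 : ∑ t : F, ψ (a * t) = 0 := by
    have := AddChar.sum_mulShift a hψ
    simpa [mul_comm, ha] using this
  have h5 := gaussSum_mulShift (quadCharC F) ψ (Units.mk0 a ha)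
  have h6 : quadCharC F a * quadCharC F a = 1 := by
    rw [quadCharC_apply, ← sq]
    exact_mod_cast quadraticChar_sq_one ha
  rw [h1]
  simp only [add_mul, one_mul, Finset.sum_add_distrib, h4, add_zero]
  rw [← h5, Units.val_mk0, ← mul_assoc, h6, one_mul, gaussSum]
  simp [quadCharC_apply]

lemma quadCharC_gaussSum_sq (hF : ringChar F ≠ 2) {ψ : AddChar F ℂ} (hψ : ψ.IsPrimitive) :
    gaussSum (quadCharC F) ψ ^ 2 = quadCharC F (-1) * Fintype.card F := by
  refine gaussSum_sq ?_ ((quadraticChar_isQuadratic F).comp _) hψ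
  exact (MulChar.ringHomComp_ne_one_iff (RingHom.injective_int _)).2 (quadraticChar_ne_one hF)

lemma sum_addChar_weighted {n : ℕ} (hF : ringChar F ≠ 2) {ψ : AddChar F ℂ} (hψ : ψ.IsPrimitive)
    {w : Fin n → F} (hw : ∏ i, w i ≠ 0) :
    ∑ x : Fin n → F, ψ (QuadraticMap.weightedSumSquares F w x) =
      quadCharC F (∏ i, w i) * gaussSum (quadCharC F) ψ ^ n := by
  have hw' : ∀ i, w i ≠ 0 := fun i => Finset.prod_ne_zero_iff.1 hw i (Finset.mem_univ i)
  have h1 : ∀ x : Fin n → F, ψ (QuadraticMap.weightedSumSquares F w x) =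
      ∏ i, ψ (w i * x i ^ 2) := fun x => by
    rw [QuadraticMap.weightedSumSquares_apply, map_sum_addChar]
    simp [sq]
  simp only [h1]
  rw [← Fintype.piFinset_univ, ← Finset.prod_univ_sum (fun _ => Finset.univ)
    (fun i y => ψ (w i * y ^ 2))]
  simp only [fun i => sum_addChar_mul_sq hF hψ (hw' i), Finset.prod_mul_distrib, map_prod]
  simp

/-- Diagonalising changes the determinant by a nonzero square, invisible to the quadratic character.
The sum then factors into 2r one-variable Gauss sums, and only the square of the Gauss sum,
χ(-1)|F|, is needed. -/
lemma sum_addChar_quadratic {r : ℕ} (hF : ringChar F ≠ 2) {ψ : AddChar F ℂ}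
    (hψ : ψ.IsPrimitive) {S : Matrix (Fin (2 * r)) (Fin (2 * r)) F} (hS : S.IsSymm)
    (hdet : S.det ≠ 0) :
    ∑ x : Fin (2 * r) → F, ψ (x ⬝ᵥ S *ᵥ x) =
      quadCharC F ((-1) ^ r * S.det) * (Fintype.card F : ℂ) ^ r := by
  have h2 : (2 : F) ≠ 0 := Ring.two_ne_zero hF
  let _ : Invertible (2 : F) := invertibleOfNonzero h2
  set q : QuadraticForm F (Fin (2 * r) → F) :=
    LinearMap.BilinMap.toQuadraticMap (Matrix.toLinearMap₂' F S)
  have hq : ∀ x, q x = x ⬝ᵥ S *ᵥ x := fun x => by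
    simp [q, Matrix.toLinearMap₂'_apply']
  obtain ⟨w, ⟨e⟩⟩ : ∃ w : Fin (2 * r) → F,
      QuadraticMap.Equivalent q (QuadraticMap.weightedSumSquares F w) := by
    have := QuadraticForm.equivalent_weightedSumSquares q
    rwa [Module.finrank_fin_fun] at this
  have hcomp : q = (LinearMap.BilinMap.toQuadraticMap
      (Matrix.toLinearMap₂' F (Matrix.diagonal w))).comp
      (e.toLinearEquiv : (Fin (2 * r) → F) →ₗ[F] (Fin (2 * r) → F)) := by
    ext x
    have hx := e.map_app x
    rw [QuadraticMap.weightedSumSquares_apply] at hx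
    rw [← hx]
    simp [Matrix.toLinearMap₂'_apply', dotProduct,
      Matrix.mulVec_diagonal, mul_left_comm]
  have hdisc : S.det = (LinearMap.toMatrix' (e.toLinearEquiv :
      (Fin (2 * r) → F) →ₗ[F] (Fin (2 * r) → F))).det ^ 2 * ∏ i, w i := by
    have h1 := congrArg QuadraticForm.discr' hcomp
    rw [QuadraticForm.discr'_comp, discr'_toQuadraticMap (Matrix.diagonal_transpose w), Matrix.det_diagonal, ← sq] at h1
    exact (discr'_toQuadraticMap hS).symm.trans h1
  set δ := (LinearMap.toMatrix' (e.toLinearEquiv :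
      (Fin (2 * r) → F) →ₗ[F] (Fin (2 * r) → F))).det
  have hδ : δ ≠ 0 := by rintro h0; simp [h0] at hdisc; exact hdet hdisc
  have hw : ∏ i, w i ≠ 0 := by rintro h0; simp [h0] at hdisc; exact hdet hdisc
  have h3 : ∑ x : Fin (2 * r) → F, ψ (x ⬝ᵥ S *ᵥ x) =
      ∑ x : Fin (2 * r) → F, ψ (QuadraticMap.weightedSumSquares F w x) := by
    rw [← Equiv.sum_comp e.toLinearEquiv.toEquiv
      (fun x => ψ (QuadraticMap.weightedSumSquares F w x))]
    refine Finset.sum_congr rfl fun x _ => ?_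
    rw [← hq]
    congr 1
    exact (e.map_app x).symm
  have h4 : quadCharC F (δ ^ 2) = 1 := by
    rw [quadCharC_apply, quadraticChar_sq_one' hδ]; simp
  rw [h3, sum_addChar_weighted hF hψ hw, pow_mul, quadCharC_gaussSum_sq hF hψ, hdisc, map_mul,
    map_mul, h4, map_pow]
  ring

end GaussPrime

/-- Modulo p, bQ has matrix (b/2)A. In even dimension the scalar multiplies the determinant by a
square, so b drops out. -/
lemma gaussQ_prime {r : ℕ} (Q : QuadraticForm ℤ (Fin (2 * r) → ℤ)) {p : ℕ} [Fact p.Prime]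
    (hp : p ≠ 2) {b : ℤ} (hb : ¬ (p : ℤ) ∣ b) (hD : ¬ (p : ℤ) ∣ (gram Q).det) :
    gaussQ Q b p = (J((-1) ^ r * (gram Q).det | p) : ℂ) * (p : ℂ) ^ r := by
  have hF : ringChar (ZMod p) ≠ 2 := by rwa [ZMod.ringChar_zmod_n]
  have h2 : (2 : ZMod p) ≠ 0 := Ring.two_ne_zero hF
  have hb' : (b : ZMod p) ≠ 0 := by rwa [Ne, ZMod.intCast_zmod_eq_zero_iff_dvd]
  have hD' : ((gram Q).det : ZMod p) ≠ 0 := by rwa [Ne, ZMod.intCast_zmod_eq_zero_iff_dvd]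
  set S : Matrix (Fin (2 * r)) (Fin (2 * r)) (ZMod p) :=
    ((b : ZMod p) / 2) • (gram Q).map (Int.cast : ℤ → ZMod p)
  have hSdet : S.det = (((b : ZMod p) / 2) ^ r) ^ 2 * ((gram Q).det : ZMod p) := by
    have h1 := RingHom.map_det (Int.castRingHom (ZMod p)) (gram Q)
    have h2 : ((gram Q).map (Int.cast : ℤ → ZMod p)).det = ((gram Q).det : ZMod p) := by
      simpa using h1.symm
    rw [Matrix.det_smul, h2, Fintype.card_fin, ← pow_mul, mul_comm r 2]
  have hne : ((b : ZMod p) / 2) ^ r ≠ 0 := pow_ne_zero _ (div_ne_zero hb' h2)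
  have hS : S.IsSymm := by
    rw [Matrix.IsSymm, Matrix.transpose_smul, ← Matrix.transpose_map, (gram_isSymm Q).eq]
  have hsum : gaussQ Q b p = ∑ x : Fin (2 * r) → ZMod p, ZMod.stdAddChar (x ⬝ᵥ S *ᵥ x) := by
    refine Finset.sum_congr rfl fun g _ => ?_
    rw [eDiv_eq_stdAddChar]
    congr 1
    have h3 : (2 : ZMod p) * ((Q (liftZ g) : ℤ) : ZMod p) =
        g ⬝ᵥ ((gram Q).map (Int.cast : ℤ → ZMod p)) *ᵥ g := by
      have := congrArg (Int.cast : ℤ → ZMod p) (two_mul_apply Q (liftZ g))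
      simp only [dotProduct, Matrix.mulVec, Int.cast_mul, Int.cast_sum, liftZ_cast] at this
      simpa [dotProduct, Matrix.mulVec] using this
    rw [Matrix.smul_mulVec, dotProduct_smul, ← h3, smul_eq_mul]
    push_cast
    field_simp
  rw [hsum, sum_addChar_quadratic hF (ZMod.isPrimitive_stdAddChar p) hS (by
    rw [hSdet]; exact mul_ne_zero (pow_ne_zero _ hne) hD'), ZMod.card, hSdet,
    ← jacobiSym.legendreSym.to_jacobiSym, mul_left_comm, map_mul]
  have h4 : quadCharC (ZMod p) ((((b : ZMod p) / 2) ^ r) ^ 2) = 1 := by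
    rw [quadCharC_apply, quadraticChar_sq_one' hne]; simp
  rw [h4, one_mul, legendreSym, quadCharC_apply]
  push_cast
  rfl

/-! ### Multipliers -/

lemma coe_smul_eq (γ : SL(2, ℤ)) (τ : ℍ) : ((γ • τ : ℍ) : ℂ) =
    ((γ 0 0 : ℂ) * τ + (γ 0 1 : ℂ)) / autFactor γ τ := by
  rw [UpperHalfPlane.specialLinearGroup_apply]; simp [autFactor]

lemma autFactor_ne_zero (γ : SL(2, ℤ)) (τ : ℍ) : autFactor γ τ ≠ 0 := by
  rw [autFactor, ← ModularGroup.denom_apply]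
  exact denom_ne_zero _ _

lemma mul_entry (γ γ' : SL(2, ℤ)) (i j : Fin 2) :
    (γ * γ' : SL(2, ℤ)) i j = γ i 0 * γ' 0 j + γ i 1 * γ' 1 j := by
  rw [Matrix.SpecialLinearGroup.coe_mul, Matrix.mul_apply, Fin.sum_univ_two]

lemma det_entries (γ : SL(2, ℤ)) : γ 0 0 * γ 1 1 - γ 0 1 * γ 1 0 = 1 := by
  have := γ.det_coe
  rwa [Matrix.det_fin_two] at this

lemma autFactor_mul (γ γ' : SL(2, ℤ)) (τ : ℍ) :
    autFactor (γ * γ') τ = autFactor γ (γ' • τ) * autFactor γ' τ := by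
  have h := autFactor_ne_zero γ' τ
  rw [autFactor, autFactor, coe_smul_eq, mul_entry, mul_entry]
  field_simp
  rw [autFactor]
  push_cast
  ring

lemma autFactor_neg (γ : SL(2, ℤ)) (τ : ℍ) : autFactor (-γ) τ = -autFactor γ τ := by
  simp [autFactor]
  ring

/-- `γ` acts on `Θ` with multiplier `χ`. -/
def HasMult {r : ℕ} (Q : QuadraticForm ℤ (Fin (2 * r) → ℤ)) (γ : SL(2, ℤ)) (χ : ℂ) : Prop :=
  ∀ (τ : ℍ) (w : Fin (2 * r) → ℂ), bigTheta Q (γ • τ : ℍ) ((autFactor γ τ)⁻¹ • w) =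
    χ * autFactor γ τ ^ r * cexp (π * I * (γ 1 0 : ℂ) * bilinC Q w w / autFactor γ τ) *
      bigTheta Q τ w

variable {r : ℕ} {Q : QuadraticForm ℤ (Fin (2 * r) → ℤ)}

/-- At τ = i, w = 0 every term of the series is a positive real number. -/
lemma bigTheta_I_ne_zero (hQ : Q.PosDef) : bigTheta Q (UpperHalfPlane.I : ℍ) 0 ≠ 0 := by
  have hs := summable_bigTheta hQ (τ := (UpperHalfPlane.I : ℍ)) (by simp) 0
  have hreal : ∀ m : Fin (2 * r) → ℤ, cexp (2 * π * I * ((UpperHalfPlane.I : ℍ) * Q m +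
      bilinC Q (vecC m) 0)) = ((Real.exp (-(2 * π * Q m)) : ℝ) : ℂ) := fun m => by
    have : bilinC Q (vecC m) 0 = 0 := by simp [bilinC]
    rw [this, Complex.ofReal_exp, UpperHalfPlane.coe_I]
    congr 1
    push_cast
    linear_combination (2 * π * (Q m : ℂ)) * Complex.I_sq
  simp only [hreal] at hs
  rw [bigTheta]
  simp only [hreal]
  rw [← Complex.ofReal_tsum, Complex.ofReal_ne_zero]
  exact ((Complex.summable_ofReal.1 hs).tsum_pos (fun _ => (Real.exp_pos _).le) 0
    (Real.exp_pos _)).ne'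

lemma HasMult.unique (hQ : Q.PosDef) {γ : SL(2, ℤ)} {χ χ' : ℂ} (h : HasMult Q γ χ)
    (h' : HasMult Q γ χ') : χ = χ' := by
  have e := (h UpperHalfPlane.I 0).symm.trans (h' UpperHalfPlane.I 0)
  exact mul_right_cancel₀ (pow_ne_zero r (autFactor_ne_zero γ _))
    (mul_right_cancel₀ (Complex.exp_ne_zero _) (mul_right_cancel₀ (bigTheta_I_ne_zero hQ) e))

lemma HasMult.mul {γ γ' : SL(2, ℤ)} {χ χ' : ℂ} (h : HasMult Q γ χ) (h' : HasMult Q γ' χ') :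
    HasMult Q (γ * γ') (χ * χ') := by
  intro τ w
  have h1 := autFactor_ne_zero γ' τ
  have h2 := autFactor_ne_zero γ (γ' • τ)
  have e := h (γ' • τ) ((autFactor γ' τ)⁻¹ • w)
  rw [h' τ w, smul_smul (autFactor γ (γ' • τ))⁻¹, ← mul_inv, ← autFactor_mul, ← mul_smul γ γ' τ, bilinC_smul_left,
    bilinC_smul_right] at e
  rw [e, autFactor_mul, mul_pow]
  have h3 : cexp (π * I * ((γ * γ' : SL(2, ℤ)) 1 0 : ℂ) * bilinC Q w w /
      (autFactor γ (γ' • τ) * autFactor γ' τ)) =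
      cexp (π * I * (γ 1 0 : ℂ) * ((autFactor γ' τ)⁻¹ * ((autFactor γ' τ)⁻¹ * bilinC Q w w)) /
        autFactor γ (γ' • τ)) * cexp (π * I * (γ' 1 0 : ℂ) * bilinC Q w w / autFactor γ' τ) := by
    rw [← Complex.exp_add]
    congr 1
    -- The cocycle relation for the exponents c/(cτ+d); it amounts to det γ' = 1.
    have h4 : ((γ * γ' : SL(2, ℤ)) 1 0 : ℂ) * autFactor γ' τ =
        γ 1 0 + γ' 1 0 * (autFactor γ (γ' • τ) * autFactor γ' τ) := by
      rw [← autFactor_mul, autFactor, autFactor, mul_entry, mul_entry]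
      have hd : (γ' 0 0 : ℂ) * γ' 1 1 - γ' 0 1 * γ' 1 0 = 1 := by exact_mod_cast det_entries γ'
      push_cast
      linear_combination (γ 1 0 : ℂ) * hd
    field_simp
    linear_combination bilinC Q w w * h4
  rw [h3]
  ring

/-- -γ acts on ℍ as γ does, cτ+d changes sign, and Θ is even in w. -/
lemma HasMult.neg {γ : SL(2, ℤ)} {χ : ℂ} (h : HasMult Q γ χ) :
    HasMult Q (-γ) ((-1) ^ r * χ) := by
  intro τ w
  have h1 : (-γ) • τ = γ • τ := by simp
  have h2 : (-autFactor γ τ)⁻¹ • w = -((autFactor γ τ)⁻¹ • w) := by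
    rw [inv_neg, _root_.neg_smul]
  rw [h1, autFactor_neg, h2, bigTheta_neg, h τ w, neg_pow (autFactor γ τ)]
  have h3 : π * I * ((-γ : SL(2, ℤ)) 1 0 : ℂ) * bilinC Q w w / -autFactor γ τ =
      π * I * (γ 1 0 : ℂ) * bilinC Q w w / autFactor γ τ := by
    simp [div_neg, neg_div]
  rw [h3]
  have h4 : ((-1 : ℂ) ^ r) * (-1) ^ r = 1 := by rw [← mul_pow]; simp
  linear_combination (-χ * autFactor γ τ ^ r * cexp (π * I * (γ 1 0 : ℂ) * bilinC Q w w /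
    autFactor γ τ) * bigTheta Q τ w) * h4

lemma hasMult_of_pos (hQ : Q.PosDef) {N : ℕ} (hN : IsLevel Q N) {γ : SL(2, ℤ)}
    (hc : (N : ℤ) ∣ γ 1 0) {d : ℕ} [NeZero d] (hd : γ 1 1 = d) :
    HasMult Q γ (gaussQ Q (γ 0 1) d / d ^ r) := by
  obtain ⟨hN0, M, hM, hMe⟩ := hN.1
  intro τ w
  have h := bigTheta_smul hQ hN0.ne' hM hMe hc (a := γ 0 0) (b := γ 0 1) (d := d)
    (by rw [← hd]; exact det_entries γ) τ.im_pos w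
  have hj : autFactor γ τ = (γ 1 0 : ℂ) * τ + d := by rw [autFactor, hd]; simp
  rw [coe_smul_eq, hj]
  exact h

/-- The matrix `(a, b; c, d)`. -/
def mkSL (a b c d : ℤ) (h : a * d - b * c = 1) : SL(2, ℤ) :=
  ⟨!![a, b; c, d], by rw [Matrix.det_fin_two_of]; exact h⟩

/-- The Gauss sum modulo 1 has a single term. This covers the unipotent matrices by which c and d
are adjusted later. -/
lemma hasMult_of_eq_one (hQ : Q.PosDef) {N : ℕ} (hN : IsLevel Q N) {γ : SL(2, ℤ)}
    (hc : (N : ℤ) ∣ γ 1 0) (hd : γ 1 1 = 1) : HasMult Q γ 1 := by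
  have h := hasMult_of_pos hQ hN hc (d := 1) (by simpa using hd)
  have h1 : gaussQ Q (γ 0 1) 1 = 1 := by
    have h2 : (liftZ (default : Fin (2 * r) → ZMod 1)) = 0 := by ext i; simp [liftZ]; rfl
    rw [gaussQ, Fintype.sum_unique, h2]
    simp [eDiv]
  simpa [h1] using h

/-! ### The Kronecker symbol -/

lemma kroneckerNat_of_odd (a : ℤ) {d : ℕ} (hd : Odd d) : kroneckerNat a d = J(a | d) := by
  have h0 : d ≠ 0 := hd.pos.ne'
  have h2 : d.factorization 2 = 0 := by
    apply Nat.factorization_eq_zero_of_not_dvd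
    rw [← even_iff_two_dvd]
    exact Nat.not_even_iff_odd.2 hd
  rw [kroneckerNat, if_neg h0, h2]
  simp

/-- Needed because `dvd_level_of_dvd_disc` only says that the primes dividing D divide N, not that D
itself does. -/
lemma jacobiSym_congr_of_dvd {x y : ℤ} {n : ℕ} (h : ∀ q : ℕ, q.Prime → q ∣ n → (q : ℤ) ∣ x - y) :
    J(x | n) = J(y | n) := by
  refine congr_arg List.prod (List.pmap_congr_left _ fun q hq h1 h2 => ?_)
  have := Fact.mk h1
  rw [legendreSym.mod q x, legendreSym.mod q y]
  congr 1
  exact Int.ModEq.symm ((Int.modEq_iff_dvd).2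
    (h q (Nat.prime_of_mem_primeFactorsList hq) (Nat.dvd_of_mem_primeFactorsList hq)))

/-- Quadratic reciprocity; for negative D the sign (-1/b) cancels the reciprocity sign. -/
lemma jacobiSym_eq_of_mod_four_one {D : ℤ} (hD : D % 4 = 1) {b : ℕ} (hb : Odd b) :
    J(D | b) = J((b : ℤ) | D.natAbs) := by
  rcases Int.natAbs_eq D with h | h
  · rw [h, Int.natAbs_natCast]
    exact jacobiSym.quadratic_reciprocity_one_mod_four (by omega) hb
  · set n := D.natAbs
    have hn : n % 4 = 3 := by omega
    rw [h, jacobiSym.neg _ hb]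
    rcases Nat.odd_mod_four_iff.1 (Nat.odd_iff.1 hb) with h1 | h3
    · rw [ZMod.χ₄_nat_one_mod_four h1, one_mul]
      exact (jacobiSym.quadratic_reciprocity_one_mod_four h1 (Nat.odd_iff.2 (by omega))).symm
    · rw [ZMod.χ₄_nat_three_mod_four h3, jacobiSym.quadratic_reciprocity_three_mod_four hn h3]
      ring

lemma jacobiSym_eq_of_mod_four_three {D : ℤ} (hD : D % 4 = 3) {b : ℕ} (hb : Odd b) :
    J(D | b) = ZMod.χ₄ b * J((b : ℤ) | D.natAbs) := by
  have h1 : (-D) % 4 = 1 := by omega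
  rw [← neg_neg D, jacobiSym.neg _ hb, jacobiSym_eq_of_mod_four_one h1 hb]
  simp

lemma kroneckerNat_eq_of_mod_four_one {D : ℤ} (hD : D % 4 = 1) {d : ℕ} (hd : d ≠ 0) :
    kroneckerNat D d = J((d : ℤ) | D.natAbs) := by
  rw [kroneckerNat, if_neg hd]
  have hodd : Odd (d / 2 ^ d.factorization 2) := by
    rw [← Nat.not_even_iff_odd, even_iff_two_dvd]
    exact Nat.not_dvd_ordCompl Nat.prime_two hd
  have hDo : Odd D.natAbs := by rw [Nat.odd_iff]; omega
  -- The symbol at 2 is insensitive to the sign of D, so the power of 2 in d obeys the same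
  -- reciprocity as its odd part.
  have h2 : ZMod.χ₈ (D : ZMod 8) = J(2 | D.natAbs) := by
    rw [jacobiSym.at_two hDo]
    rcases Int.natAbs_eq D with h | h
    · nth_rewrite 1 [h]; simp
    · nth_rewrite 1 [h]
      rw [ZMod.χ₈_int_eq_if_mod_eight, ZMod.χ₈_nat_eq_if_mod_eight]
      split_ifs <;> first | rfl | omega
  rw [jacobiSym_eq_of_mod_four_one hD hodd, h2, ← jacobiSym.pow_left, ← jacobiSym.mul_left]
  congr 1
  exact_mod_cast Nat.ordProj_mul_ordCompl_eq_self d 2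

/-! ### The multiplier for odd d -/

variable {r : ℕ} {Q : QuadraticForm ℤ (Fin (2 * r) → ℤ)}

/-- The discriminant `(-1)^r det A`. -/
abbrev disc (Q : QuadraticForm ℤ (Fin (2 * r) → ℤ)) : ℤ := (-1) ^ r * (gram Q).det

/-- Taking determinants in AM = N gives det A · det M = N^{2r}. -/
lemma dvd_level_of_dvd_det {N : ℕ} (hN : IsLevel Q N) {q : ℕ} (hq : q.Prime)
    (h : (q : ℤ) ∣ (gram Q).det) : (q : ℤ) ∣ N := by
  obtain ⟨_, M, hM, _⟩ := hN.1
  have h1 := congrArg Matrix.det hM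
  rw [Matrix.det_mul, Matrix.det_smul, Matrix.det_one, mul_one] at h1
  have h2 : (q : ℤ) ∣ (N : ℤ) ^ Fintype.card (Fin (2 * r)) := h1 ▸ h.mul_right _
  exact (Nat.prime_iff_prime_int.1 hq).dvd_of_dvd_pow h2

lemma natAbs_disc : (disc Q).natAbs = (gram Q).det.natAbs := by
  rw [disc, Int.natAbs_mul, Int.natAbs_pow]; simp

lemma dvd_level_of_dvd_disc {N : ℕ} (hN : IsLevel Q N) {q : ℕ} (hq : q.Prime)
    (h : q ∣ (disc Q).natAbs) : (q : ℤ) ∣ N := by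
  rw [natAbs_disc, ← Int.natCast_dvd] at h
  exact dvd_level_of_dvd_det hN hq h

lemma not_dvd_of_dvd_entry {γ : SL(2, ℤ)} {q : ℕ} (hq : q.Prime) (h : (q : ℤ) ∣ γ 1 0) :
    ¬ (q : ℤ) ∣ γ 1 1 := fun h' => by
  have h1 := det_entries γ
  have : (q : ℤ) ∣ 1 := h1 ▸ dvd_sub (h'.mul_left _) (h.mul_left _)
  exact hq.one_lt.ne' (by exact_mod_cast Int.natAbs_dvd_natAbs.2 this |> Nat.dvd_one.1)

lemma hasMult_prime (hQ : Q.PosDef) {N : ℕ} (hN : IsLevel Q N) {γ : SL(2, ℤ)}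
    (hc : (N : ℤ) ∣ γ 1 0) {p : ℕ} (hp : p.Prime) (hp2 : p ≠ 2) (hd : γ 1 1 = p) :
    HasMult Q γ (J(disc Q | p) : ℤ) := by
  have : Fact p.Prime := ⟨hp⟩
  have h := hasMult_of_pos hQ hN hc hd
  have hb : ¬ (p : ℤ) ∣ γ 0 1 := fun hb => by
    have h1 := det_entries γ
    have : (p : ℤ) ∣ 1 := h1 ▸ dvd_sub ((hd ▸ dvd_rfl : (p : ℤ) ∣ γ 1 1).mul_left _) (hb.mul_right _)
    exact hp.one_lt.ne' (by exact_mod_cast Int.natAbs_dvd_natAbs.2 this |> Nat.dvd_one.1)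
  have hD : ¬ (p : ℤ) ∣ (gram Q).det := fun hD =>
    not_dvd_of_dvd_entry hp ((dvd_level_of_dvd_det hN hp hD).trans hc) (hd ▸ dvd_rfl)
  rw [gaussQ_prime Q hp2 hb hD, mul_div_assoc, div_self, mul_one] at h
  · exact h
  · exact pow_ne_zero _ (by exact_mod_cast hp.ne_zero)

/-- Multiplication by a unipotent matrix on the right does not change the multiplier. -/
lemma HasMult.of_mul_right (hQ : Q.PosDef) {N : ℕ} (hN : IsLevel Q N) {γ u : SL(2, ℤ)} {χ : ℂ}
    (h : HasMult Q (γ * u) χ) (hu0 : (N : ℤ) ∣ u 1 0) (hu : u 0 0 = 1) : HasMult Q γ χ := by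
  have hi : HasMult Q u⁻¹ 1 := by
    refine hasMult_of_eq_one hQ hN ?_ ?_
    · rw [Matrix.SpecialLinearGroup.coe_inv, Matrix.adjugate_fin_two]
      simpa using hu0
    · rw [Matrix.SpecialLinearGroup.coe_inv, Matrix.adjugate_fin_two]
      simpa using hu
  have := h.mul hi
  rwa [mul_inv_cancel_right, mul_one] at this

/-- The matrix `(1, 0; n, 1)`. -/
def lowerU (n : ℤ) : SL(2, ℤ) := mkSL 1 0 n 1 (by ring)

/-- The matrix `(1, n; 0, 1)`. -/
def upperU (n : ℤ) : SL(2, ℤ) := mkSL 1 n 0 1 (by ring)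

lemma mul_lowerU (γ : SL(2, ℤ)) (n : ℤ) :
    (γ * lowerU n) 1 0 = γ 1 0 + γ 1 1 * n ∧ (γ * lowerU n) 1 1 = γ 1 1 := by
  rw [mul_entry, mul_entry]
  simp [lowerU, mkSL]

lemma mul_upperU (γ : SL(2, ℤ)) (n : ℤ) :
    (γ * upperU n) 1 0 = γ 1 0 ∧ (γ * upperU n) 1 1 = γ 1 1 + γ 1 0 * n := by
  rw [mul_entry, mul_entry]
  simp [upperU, mkSL, add_comm]

lemma HasMult.of_mul_lowerU (hQ : Q.PosDef) {N : ℕ} (hN : IsLevel Q N) {γ : SL(2, ℤ)} {n : ℤ}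
    {χ : ℂ} (h : HasMult Q (γ * lowerU n) χ) (hn : (N : ℤ) ∣ n) : HasMult Q γ χ :=
  h.of_mul_right hQ hN (by simpa [lowerU, mkSL] using hn) (by simp [lowerU, mkSL])

lemma HasMult.of_mul_upperU (hQ : Q.PosDef) {N : ℕ} (hN : IsLevel Q N) {γ : SL(2, ℤ)} {n : ℤ}
    {χ : ℂ} (h : HasMult Q (γ * upperU n) χ) : HasMult Q γ χ :=
  h.of_mul_right hQ hN (by simp [upperU, mkSL]) (by simp [upperU, mkSL])

lemma isCoprime_entries (γ : SL(2, ℤ)) : IsCoprime (γ 1 1) (γ 1 0) :=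
  ⟨γ 0 0, -γ 0 1, by linear_combination det_entries γ⟩

/-- Right multiplication by unipotents adds multiples of Nd to c, or multiples of c to d, and keeps
the multiplier. Once 4D divides c, Dirichlet's theorem replaces d by a prime p ≡ d mod c, and (D/p)
= (D/d) because the symbol is periodic modulo 4|D|. -/
lemma hasMult_odd (hQ : Q.PosDef) {N : ℕ} (hN : IsLevel Q N) {γ : SL(2, ℤ)}
    (hc : (N : ℤ) ∣ γ 1 0) {d : ℕ} (hd : γ 1 1 = d) (hodd : Odd d) :
    HasMult Q γ (J(disc Q | d) : ℤ) := by
  by_cases hd1 : d = 1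
  · subst hd1
    simpa using hasMult_of_eq_one hQ hN hc (by simpa using hd)
  have hcop : IsCoprime (d : ℤ) (4 * (disc Q).natAbs : ℕ) := by
    rw [Nat.isCoprime_iff_coprime]
    refine Nat.Coprime.mul_right ?_ ?_
    · exact (Nat.Coprime.pow_right 2 (Nat.coprime_two_right.2 hodd) : Nat.Coprime d (2 ^ 2))
    · refine Nat.coprime_of_dvd fun q hq h1 h2 => ?_
      refine not_dvd_of_dvd_entry hq ((dvd_level_of_dvd_disc hN hq h2).trans hc) ?_
      rw [hd]; exact_mod_cast h1
  obtain ⟨c₀, hc₀⟩ := hc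
  obtain ⟨s, t, hst⟩ := hcop
  -- make the lower left entry divisible by `4 D`
  have hn : ∃ n : ℤ, ((4 * (disc Q).natAbs : ℕ) : ℤ) ∣ c₀ + d * n :=
    ⟨-(c₀ * s), c₀ * t, by linear_combination (-c₀) * hst⟩
  obtain ⟨n, hn⟩ := hn
  refine HasMult.of_mul_lowerU hQ hN (n := N * n) ?_ (dvd_mul_right _ _)
  obtain ⟨h10, h11⟩ := mul_lowerU γ (N * n)
  set γ₁ := γ * lowerU (N * n)
  have hc1 : γ₁ 1 0 = N * (c₀ + d * n) := by rw [h10, hc₀, hd]; ring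
  have hd1' : γ₁ 1 1 = d := h11.trans hd
  -- If c = 0 then d = 1, which was treated apart: the progression needs a nonzero modulus.
  have hne : γ₁ 1 0 ≠ 0 := fun h0 => hd1 <| by
    have := det_entries γ₁
    rw [h0, mul_zero, sub_zero, hd1'] at this
    have h3 : (d : ℤ) ∣ 1 := Dvd.intro_left _ this
    exact_mod_cast Int.eq_one_of_dvd_one (by positivity) h3
  -- make the lower right entry a prime
  obtain ⟨p, hpgt, hp, hpmod⟩ := Nat.forall_exists_prime_gt_and_zmodEq 2
    (q := (γ₁ 1 0).natAbs) (a := d) (Int.natAbs_ne_zero.2 hne)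
    (by rw [← hd1', Int.natCast_natAbs, IsCoprime.abs_right_iff]
        exact isCoprime_entries γ₁)
  have hdvd : γ₁ 1 0 ∣ (p : ℤ) - d := Int.natAbs_dvd.1 hpmod.symm.dvd
  obtain ⟨m, hm⟩ := hdvd
  refine HasMult.of_mul_upperU hQ hN (n := m) ?_
  obtain ⟨h10', h11'⟩ := mul_upperU γ₁ m
  have h := hasMult_prime hQ hN (γ := γ₁ * upperU m) (by rw [h10', hc1]; exact dvd_mul_right _ _)
    hp (by omega) (by rw [h11', hd1']; linarith)
  have hpodd : Odd p := hp.odd_of_ne_two (by omega)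
  have hJ : J(disc Q | p) = J(disc Q | d) := by
    rw [jacobiSym.mod_right _ hpodd, jacobiSym.mod_right _ hodd]
    congr 1
    have h4 : ((4 * (disc Q).natAbs : ℕ) : ℤ) ∣ (d : ℤ) - p := by
      rw [← neg_sub, dvd_neg, hm, hc1]
      exact (hn.mul_left _).mul_right _
    exact (Nat.modEq_iff_dvd.2 h4)
  rwa [hJ] at h

/-! ### The multiplier for even and negative d, and the character -/

variable {r : ℕ} {Q : QuadraticForm ℤ (Fin (2 * r) → ℤ)}

lemma odd_disc {N : ℕ} (hN : IsLevel Q N) (hNo : Odd N) : Odd (disc Q).natAbs := by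
  rw [← Nat.not_even_iff_odd, even_iff_two_dvd]
  intro h
  have := dvd_level_of_dvd_disc hN Nat.prime_two h
  exact Nat.not_even_iff_odd.2 hNo (even_iff_two_dvd.2 (by exact_mod_cast this))

/-- The matrix (1, 1; 2N, 2N+1) is a product of unipotents with multiplier 1. If D ≡ 3 mod 4,
`hasMult_odd` and reciprocity would give it the multiplier χ₄(2N+1) = -1, as 2N+1 ≡ 3 mod 4 and 2N+1
≡ 1 modulo every prime dividing D. -/
lemma disc_mod_four (hQ : Q.PosDef) {N : ℕ} (hN : IsLevel Q N) (hNo : Odd N) :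
    disc Q % 4 = 1 := by
  have hDo := odd_disc hN hNo
  rw [Nat.odd_iff] at hDo
  by_contra hne
  have h3 : disc Q % 4 = 3 := by omega
  have hodd : Odd (2 * N + 1) := odd_two_mul_add_one N
  have h1 : HasMult Q (lowerU (2 * N) * upperU 1) (J(disc Q | 2 * N + 1) : ℤ) := by
    refine hasMult_odd hQ hN ?_ ?_ hodd
    · rw [(mul_upperU _ _).1]; simp [lowerU, mkSL]
    · rw [(mul_upperU _ _).2]; simp [lowerU, mkSL, add_comm]
  have h2 : HasMult Q (lowerU (2 * N)) 1 :=
    hasMult_of_eq_one hQ hN (by simp [lowerU, mkSL]) (by simp [lowerU, mkSL])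
  have h4 : J(disc Q | 2 * N + 1) = 1 := by
    exact_mod_cast (h1.of_mul_upperU hQ hN).unique hQ h2
  rw [jacobiSym_eq_of_mod_four_three h3 hodd] at h4
  have h5 : J(((2 * N + 1 : ℕ) : ℤ) | (disc Q).natAbs) = J(1 | (disc Q).natAbs) := by
    refine jacobiSym_congr_of_dvd fun q hq hqD => ?_
    have := dvd_level_of_dvd_disc hN hq hqD
    push_cast
    rw [add_sub_cancel_right]
    exact this.mul_left 2
  have h6 : (2 * N + 1) % 4 = 3 := by
    obtain ⟨k, rfl⟩ := hNo
    omega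
  rw [h5, jacobiSym.one_left, ZMod.χ₄_nat_three_mod_four h6] at h4
  norm_num at h4

lemma eps_natCast (Q : QuadraticForm ℤ (Fin (2 * r) → ℤ)) (d : ℕ) :
    eps Q d = kroneckerNat (disc Q) d := by
  rw [eps, if_neg (by omega), one_mul, Int.natAbs_natCast]

lemma hasMult_eps_of_nonneg (hQ : Q.PosDef) {N : ℕ} (hN : IsLevel Q N) {γ : SL(2, ℤ)}
    (hc : (N : ℤ) ∣ γ 1 0) {d : ℕ} (hd : γ 1 1 = d) : HasMult Q γ (eps Q d : ℤ) := by
  rw [eps_natCast]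
  rcases Nat.even_or_odd d with heven | hodd
  swap
  · rw [kroneckerNat_of_odd _ hodd]
    exact hasMult_odd hQ hN hc hd hodd
  have hdet := det_entries γ
  have hcodd : Odd (γ 1 0) := by
    rw [← Int.not_even_iff_odd, even_iff_two_dvd]
    intro h
    exact not_dvd_of_dvd_entry Nat.prime_two h (hd ▸ by exact_mod_cast heven.two_dvd)
  have hNo : Odd N := by
    have := Int.Odd.of_mul_left (m := (N : ℤ)) (n := γ 1 0 / N) (by rwa [Int.mul_ediv_cancel' hc])
    exact_mod_cast this
  have hD4 := disc_mod_four hQ hN hNo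
  -- Adding c·c to d makes it odd, keeps it nonnegative, and preserves it modulo the primes of D,
  -- which divide c.
  set d' : ℕ := d + (γ 1 0 ^ 2).natAbs
  have hd' : (d' : ℤ) = d + γ 1 0 * γ 1 0 := by
    simp only [d', Nat.cast_add, Int.natCast_natAbs, abs_sq]
    ring
  have hd'odd : Odd d' := by
    have : Odd (d' : ℤ) := by
      rw [hd']
      exact Even.add_odd (by exact_mod_cast heven) (hcodd.mul hcodd)
    exact_mod_cast this
  have h1 : HasMult Q (γ * upperU (γ 1 0)) (J(disc Q | d') : ℤ) := by
    refine hasMult_odd hQ hN ?_ ?_ hd'odd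
    · rwa [(mul_upperU _ _).1]
    · rw [(mul_upperU _ _).2, hd', hd]
  have h2 := h1.of_mul_upperU hQ hN
  have h3 : J((d' : ℤ) | (disc Q).natAbs) = J((d : ℤ) | (disc Q).natAbs) := by
    refine jacobiSym_congr_of_dvd fun q hq hqD => ?_
    rw [hd', add_sub_cancel_left]
    exact ((dvd_level_of_dvd_disc hN hq hqD).trans hc).mul_left _
  rw [jacobiSym_eq_of_mod_four_one hD4 hd'odd, h3] at h2
  -- d = 0 forces c = ±1, hence N = 1 and |D| = 1.
  by_cases hd0 : d = 0
  · subst hd0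
    have hN1 : N = 1 := by
      obtain ⟨c', hc'⟩ := hc
      rw [hd, hc'] at hdet
      have h5 : (N : ℤ) ∣ 1 := ⟨-(γ 0 1 * c'), by push_cast at hdet; linear_combination -hdet⟩
      exact_mod_cast Int.eq_one_of_dvd_one (by positivity) h5
    have hD1 : (disc Q).natAbs = 1 := by
      by_contra hne
      obtain ⟨q, hq, hqD⟩ := Nat.exists_prime_and_dvd hne
      have := dvd_level_of_dvd_disc hN hq hqD
      rw [hN1] at this
      exact hq.one_lt.ne' (by exact_mod_cast Int.eq_one_of_dvd_one (by positivity) this)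
    rw [hD1, jacobiSym.one_right] at h2
    rw [kroneckerNat, if_pos rfl, if_pos hD1]
    exact h2
  · rw [kroneckerNat_eq_of_mod_four_one hD4 hd0]
    exact h2

/-- The multiplier of `Θ` on `Γ_0(N)` is `ε(d)`. -/
theorem hasMult_eps (hQ : Q.PosDef) {N : ℕ} (hN : IsLevel Q N) {γ : SL(2, ℤ)}
    (hγ : γ ∈ CongruenceSubgroup.Gamma0 N) : HasMult Q γ (eps Q (γ 1 1)) := by
  have hc : (N : ℤ) ∣ γ 1 0 := by
    rw [← ZMod.intCast_zmod_eq_zero_iff_dvd]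
    exact CongruenceSubgroup.Gamma0_mem.1 hγ
  rcases le_or_gt 0 (γ 1 1) with h | h
  · have := hasMult_eps_of_nonneg hQ hN hc (Int.natAbs_of_nonneg h).symm
    rwa [Int.natAbs_of_nonneg h] at this
  · have h1 : (-γ) 1 1 = ((γ 1 1).natAbs : ℤ) := by
      rw [Int.ofNat_natAbs_of_nonpos h.le]; simp
    have h2 := (hasMult_eps_of_nonneg hQ hN (γ := -γ) (by simpa using hc) h1).neg
    rw [neg_neg, eps_natCast] at h2
    rw [eps, if_pos h]
    push_cast
    exact h2

/-- `γ ↦ ε(d)` as a character of `Γ_0(N)`. -/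
def epsChar (hQ : Q.PosDef) {N : ℕ} (hN : IsLevel Q N) : CongruenceSubgroup.Gamma0 N →* ℂˣ :=
  MonoidHom.toHomUnits
    { toFun := fun γ => (eps Q ((γ : SL(2, ℤ)) 1 1) : ℂ)
      -- Both homomorphism laws come from uniqueness of multipliers; invertibility is automatic on a
      -- group.
      map_one' := (hasMult_eps hQ hN (one_mem _)).unique hQ
        (hasMult_of_eq_one hQ hN (by simp) (by simp))
      map_mul' := fun γ γ' => (hasMult_eps hQ hN (mul_mem γ.2 γ'.2)).unique hQ
        ((hasMult_eps hQ hN γ.2).mul (hasMult_eps hQ hN γ'.2)) }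

lemma epsChar_apply (hQ : Q.PosDef) {N : ℕ} (hN : IsLevel Q N)
    (γ : CongruenceSubgroup.Gamma0 N) :
    (epsChar hQ hN γ : ℂ) = (eps Q ((γ : SL(2, ℤ)) 1 1) : ℂ) := rfl

/-! ### The theta series -/

section Series

variable {f n : ℕ} {Q : QuadraticForm ℤ (Fin f → ℤ)} {h : Fin n → Fin f → ℤ} {v : Fin f → ℂ}

/-- The vector `∑_j z_j h_j`. -/
def hvec (h : Fin n → Fin f → ℤ) (z : Fin n → ℂ) : Fin f → ℂ := ∑ j, z j • vecC (h j)

lemma bilinC_sum_right (Q : QuadraticForm ℤ (Fin f → ℤ)) (x : Fin f → ℂ) {ι : Type*}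
    (s : Finset ι) (y : ι → Fin f → ℂ) : bilinC Q x (∑ i ∈ s, y i) = ∑ i ∈ s, bilinC Q x (y i) := by
  simp [bilinC, Matrix.mulVec_sum, dotProduct_sum]

lemma bilinC_hvec_right (Q : QuadraticForm ℤ (Fin f → ℤ)) (h : Fin n → Fin f → ℤ)
    (x : Fin f → ℂ) (z : Fin n → ℂ) :
    bilinC Q x (hvec h z) = ∑ j, z j * bilinC Q x (vecC (h j)) := by
  simp [hvec, bilinC_sum_right, bilinC_smul_right]

lemma bilinC_hvec_hvec (Q : QuadraticForm ℤ (Fin f → ℤ)) (h : Fin n → Fin f → ℤ)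
    (x z : Fin n → ℂ) : bilinC Q (hvec h x) (hvec h z) =
      bilinOf ((gramOf Q h).map (Int.cast : ℤ → ℝ)) x z := by
  rw [bilinC_hvec_right, bilinOf, Matrix.dotProduct_mulVec]
  simp only [dotProduct, Matrix.vecMul]
  refine Finset.sum_congr rfl fun j _ => ?_
  rw [bilinC_comm, bilinC_hvec_right, mul_comm]
  congr 1
  refine Finset.sum_congr rfl fun i _ => ?_
  rw [bilinC_comm, bilinC_vecC]
  simp [gramOf]

lemma hvec_add (h : Fin n → Fin f → ℤ) (x y : Fin n → ℂ) :
    hvec h (x + y) = hvec h x + hvec h y := by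
  simp [hvec, add_smul, Finset.sum_add_distrib]

lemma hvec_smul (h : Fin n → Fin f → ℤ) (a : ℂ) (x : Fin n → ℂ) :
    hvec h (a • x) = a • hvec h x := by
  simp [hvec, Finset.smul_sum, smul_smul]

lemma hvec_vecC (h : Fin n → Fin f → ℤ) (x : Fin n → ℤ) :
    hvec h (vecC x) = vecC (∑ j, x j • h j) := by
  ext i
  simp [hvec, vecC]

lemma thetaTerm_eq (Q : QuadraticForm ℤ (Fin f → ℤ)) (h : Fin n → Fin f → ℤ) (v : Fin f → ℂ)
    (k : ℕ) (τ : ℍ) (z : Fin n → ℂ) (m : Fin f → ℤ) :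
    thetaTerm Q h v k τ z m = bilinC Q v (vecC m) ^ k *
      cexp (2 * π * I * (τ * Q m + bilinC Q (vecC m) (hvec h z))) := by
  rw [thetaTerm, bilinC_hvec_right, mul_add, Complex.exp_add, ← mul_assoc, Finset.mul_sum,
    Complex.exp_sum, ← Complex.exp_int_mul]
  congr 1
  · congr 2
    ring
  · refine Finset.prod_congr rfl fun j _ => ?_
    rw [← Complex.exp_int_mul, bilinC_vecC]
    congr 1
    ring

lemma norm_bilinC_le (Q : QuadraticForm ℤ (Fin f → ℤ)) (v : Fin f → ℂ) :
    ∃ C : ℝ, 0 ≤ C ∧ ∀ m : Fin f → ℤ, ‖bilinC Q v (vecC m)‖ ≤ C * ‖m‖ := by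
  refine ⟨f * ‖(gram Q).map (Int.cast : ℤ → ℂ) *ᵥ v‖, by positivity, fun m => ?_⟩
  rw [bilinC_comm, bilinC]
  refine (norm_dotProduct_le _ _).trans (le_of_eq ?_)
  rw [norm_vecC]
  ring

lemma pow_le_factorial_mul_exp {x : ℝ} (hx : 0 ≤ x) (l : ℕ) : x ^ l ≤ (l ! : ℝ) * Real.exp x := by
  have := Real.pow_div_factorial_le_exp x hx l
  rwa [div_le_iff₀' (by positivity)] at this

/-- The exponentials in `Θ` are bounded, locally uniformly in `τ` and `w`. -/
lemma exists_norm_bigTheta_term_le (hQ : Q.PosDef) {ε : ℝ} (hε : 0 < ε) (R : ℝ) :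
    ∃ c C : ℝ, 0 < c ∧ ∀ (τ : ℂ) (w : Fin f → ℂ), ε ≤ τ.im → ‖w‖ ≤ R → ∀ m : Fin f → ℤ,
      ‖cexp (2 * π * I * (τ * Q m + bilinC Q (vecC m) w))‖ ≤
        Real.exp (-c * ‖m‖ ^ 2 + C * ‖m‖) := by
  obtain ⟨c, hc, hA⟩ := exists_posDef_bound (gramR_posDef hQ)
  have hpi := Real.pi_pos
  let T : (Fin f → ℂ) →L[ℂ] (Fin f → ℂ) :=
    LinearMap.toContinuousLinearMap (Matrix.mulVecLin ((gram Q).map (Int.cast : ℤ → ℂ)))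
  refine ⟨π * ε * c, 2 * π * f * (‖T‖ * R), by positivity, fun τ w hτ hw m => ?_⟩
  rw [bigTheta_term]
  refine (norm_theta_term_le hA (hε.le.trans hτ) _ m).trans (Real.exp_le_exp.2 ?_)
  have h1 : ‖(gram Q).map (Int.cast : ℤ → ℂ) *ᵥ w‖ ≤ ‖T‖ * R :=
    (T.le_opNorm w).trans (mul_le_mul_of_nonneg_left hw (norm_nonneg _))
  gcongr

/-- The factor e^{C‖m‖} dominates both B(v,m)^l and the terms e^{|sB(v,m)|} of the generating
function. -/
lemma summable_exp_mul_bigTheta_term (hQ : Q.PosDef) {τ : ℂ} (hτ : 0 < τ.im) (w : Fin f → ℂ)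
    (C : ℝ) : Summable fun m : Fin f → ℤ => Real.exp (C * ‖m‖) *
      ‖cexp (2 * π * I * (τ * Q m + bilinC Q (vecC m) w))‖ := by
  obtain ⟨c, C', hc, hb⟩ := exists_norm_bigTheta_term_le hQ hτ ‖w‖
  refine (summable_exp_neg_norm_sq hc (C' + C)).of_nonneg_of_le (fun m => by positivity)
    fun m => ?_
  refine (mul_le_mul_of_nonneg_left (hb τ w le_rfl le_rfl m) (Real.exp_pos _).le).trans
    (le_of_eq ?_)
  rw [← Real.exp_add]
  congr 1
  ring

lemma summable_thetaTerm (hQ : Q.PosDef) (h : Fin n → Fin f → ℤ) (v : Fin f → ℂ) (l : ℕ) (τ : ℍ)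
    (z : Fin n → ℂ) : Summable (thetaTerm Q h v l τ z) := by
  obtain ⟨C, hC, hb⟩ := norm_bilinC_le Q v
  refine ((summable_exp_mul_bigTheta_term hQ τ.im_pos (hvec h z) C).mul_left
    (l ! : ℝ)).of_norm_bounded fun m => ?_
  rw [thetaTerm_eq, norm_mul, norm_pow, ← mul_assoc]
  refine mul_le_mul_of_nonneg_right ?_ (norm_nonneg _)
  exact (pow_le_pow_left₀ (norm_nonneg _) (hb m) l).trans
    (pow_le_factorial_mul_exp (by positivity) l)

lemma bilinC_hvec_eq_zero (hv : ∀ j, bilinC Q v (vecC (h j)) = 0) (z : Fin n → ℂ) :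
    bilinC Q v (hvec h z) = 0 := by
  rw [bilinC_hvec_right]
  simp [hv]

lemma theta_elliptic (hv : ∀ j, bilinC Q v (vecC (h j)) = 0) (l : ℕ) (lam mu : Fin n → ℤ)
    (τ : ℍ) (z : Fin n → ℂ) :
    theta Q h v l τ (fun j => z j + (lam j : ℂ) * τ + (mu j : ℂ)) =
      cexp (-(π * I *
          (bilinOf ((gramOf Q h).map (Int.cast : ℤ → ℝ)) (vecC lam) (vecC lam) * τ +
            2 * bilinOf ((gramOf Q h).map (Int.cast : ℤ → ℝ)) z (vecC lam)))) *
          theta Q h v l τ z := by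
  set x : Fin f → ℤ := ∑ j, lam j • h j
  have hx : hvec h (vecC lam) = vecC x := hvec_vecC h lam
  have hz : (fun j => z j + (lam j : ℂ) * τ + (mu j : ℂ)) =
      z + (τ : ℂ) • vecC lam + vecC mu := by
    ext j; simp [vecC, mul_comm]
  rw [hz, theta, theta, ← (Equiv.addRight x).tsum_eq (thetaTerm Q h v l τ z), ← tsum_mul_left]
  refine tsum_congr fun m => ?_
  -- Orthogonality of v to the h_j makes the polynomial factor invariant under m ↦ m + ∑ λ_j h_j.
  have h1 : bilinC Q v (vecC (m + x)) = bilinC Q v (vecC m) := by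
    rw [vecC_add, bilinC_add_right, ← hx, bilinC_hvec_eq_zero hv, add_zero]
  rw [Equiv.coe_addRight, thetaTerm_eq, thetaTerm_eq, h1, mul_left_comm, ← Complex.exp_add]
  congr 1
  rw [hvec_add, hvec_add, hvec_smul, bilinC_add_right, bilinC_add_right, bilinC_smul_right, hx,
    ← bilinC_hvec_hvec, ← bilinC_hvec_hvec, hx, bilinC_vecC_self, apply_add, vecC_add,
    bilinC_add_left, bilinC_comm Q (hvec h z), hvec_vecC, bilinC_vecC Q m, bilinC_vecC Q m,
    polar_eq, polar_eq, Complex.exp_eq_exp_iff_exists_int]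
  -- The shift by μ contributes only e of the integer B(m, ∑ μ_j h_j).
  refine ⟨m ⬝ᵥ gram Q *ᵥ ∑ j, mu j • h j, ?_⟩
  push_cast
  ring

lemma Psi_elliptic (hv : ∀ j, bilinC Q v (vecC (h j)) = 0) (k : ℕ) (lam mu : Fin n → ℤ)
    (τ : ℍ) (z : Fin n → ℂ) :
    Psi Q h v k τ (fun j => z j + (lam j : ℂ) * τ + (mu j : ℂ)) =
      cexp (-(π * I *
          (bilinOf ((gramOf Q h).map (Int.cast : ℤ → ℝ)) (vecC lam) (vecC lam) * τ +
            2 * bilinOf ((gramOf Q h).map (Int.cast : ℤ → ℝ)) z (vecC lam)))) *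
          Psi Q h v k τ z := by
  rw [Psi, Psi, Finset.mul_sum]
  refine Finset.sum_congr rfl fun t _ => ?_
  rw [theta_elliptic hv]
  ring

end Series

/-! ### The generating function of the `Psi` -/

lemma eq_of_hasSum_pow {a b : ℕ → ℂ} {F : ℂ → ℂ} (ha : ∀ s, HasSum (fun k => a k * s ^ k) (F s))
    (hb : ∀ s, HasSum (fun k => b k * s ^ k) (F s)) : a = b := by
  have key : ∀ {c : ℕ → ℂ}, (∀ s, HasSum (fun k => c k * s ^ k) (F s)) →
      HasFPowerSeriesAt F (FormalMultilinearSeries.ofScalars ℂ c) 0 := fun {c} hc => by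
    rw [hasFPowerSeriesAt_iff]
    refine Filter.Eventually.of_forall fun s => ?_
    simpa [FormalMultilinearSeries.coeff_ofScalars, mul_comm] using hc s
  have h := (key ha).eq_formalMultilinearSeries (key hb)
  funext k
  have := congrArg (fun p => p.coeff k) h
  simpa [FormalMultilinearSeries.coeff_ofScalars] using this

section Generating

variable {f n : ℕ} {Q : QuadraticForm ℤ (Fin f → ℤ)}

/-- Shifting w by (s/2πi)v multiplies the m-th term of Θ by e^{sB(v,m)}; expanding it gives an
absolutely convergent double series, summed in the other order. -/
lemma hasSum_theta (hQ : Q.PosDef) (h : Fin n → Fin f → ℤ) (v : Fin f → ℂ) (τ : ℍ)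
    (z : Fin n → ℂ) (s : ℂ) :
    HasSum (fun l : ℕ => theta Q h v l τ z / (l ! : ℂ) * s ^ l)
      (bigTheta Q τ (hvec h z + (s / (2 * π * I)) • v)) := by
  set e : (Fin f → ℤ) → ℂ := fun m => cexp (2 * π * I * (τ * Q m + bilinC Q (vecC m) (hvec h z)))
  set F : (Fin f → ℤ) × ℕ → ℂ := fun p =>
    (s * bilinC Q v (vecC p.1)) ^ p.2 / (p.2 ! : ℂ) * e p.1
  have hF1 : ∀ m, HasSum (fun l => F (m, l)) (cexp (s * bilinC Q v (vecC m)) * e m) := fun m => by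
    have := NormedSpace.expSeries_div_hasSum_exp (s * bilinC Q v (vecC m))
    rw [← Complex.exp_eq_exp_ℂ] at this
    exact this.mul_right (e m)
  have hFn : ∀ m, HasSum (fun l => ‖F (m, l)‖)
      (Real.exp ‖s * bilinC Q v (vecC m)‖ * ‖e m‖) := fun m => by
    have := NormedSpace.expSeries_div_hasSum_exp ‖s * bilinC Q v (vecC m)‖
    rw [← Real.exp_eq_exp_ℝ] at this
    refine (this.mul_right ‖e m‖).congr_fun ?_
    intro l
    simp [F]
  have hF : Summable F := by
    refine Summable.of_norm ?_
    rw [summable_prod_of_nonneg fun p => norm_nonneg _]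
    refine ⟨fun m => (hFn m).summable, ?_⟩
    simp only [fun m => (hFn m).tsum_eq]
    obtain ⟨C, hC, hb⟩ := norm_bilinC_le Q v
    refine (summable_exp_mul_bigTheta_term hQ τ.im_pos (hvec h z) (‖s‖ * C)).of_nonneg_of_le
      (fun m => by positivity) fun m => ?_
    refine mul_le_mul_of_nonneg_right (Real.exp_le_exp.2 ?_) (norm_nonneg _)
    rw [norm_mul, mul_assoc]
    exact mul_le_mul_of_nonneg_left (hb m) (norm_nonneg _)
  have hval : ∑' p, F p = bigTheta Q τ (hvec h z + (s / (2 * π * I)) • v) := by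
    rw [hF.tsum_prod, bigTheta]
    refine tsum_congr fun m => ?_
    rw [(hF1 m).tsum_eq, ← Complex.exp_add]
    congr 1
    rw [bilinC_add_right, bilinC_smul_right, bilinC_comm Q (vecC m) v]
    have := Complex.two_pi_I_ne_zero
    field_simp
    ring
  rw [← hval]
  have hsw : HasSum (fun p : ℕ × (Fin f → ℤ) => F p.swap) (∑' p, F p) :=
    (Equiv.prodComm ℕ (Fin f → ℤ)).hasSum_iff.2 hF.hasSum
  refine hsw.prod_fiberwise fun l => ?_
  have h1 := (summable_thetaTerm hQ h v l τ z).hasSum.mul_right (s ^ l / (l ! : ℂ))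
  have h2 : theta Q h v l τ z / (l ! : ℂ) * s ^ l =
      (∑' m, thetaTerm Q h v l τ z m) * (s ^ l / (l ! : ℂ)) := by
    rw [theta]; ring
  rw [h2]
  refine h1.congr_fun fun m => ?_
  rw [thetaTerm_eq]
  simp only [F, Prod.swap, mul_pow]
  ring

lemma hasSum_mul_prod {ι κ : Type*} {F : ι → ℂ} {H : κ → ℂ} {a b : ℂ} (hF : HasSum F a)
    (hH : HasSum H b) : HasSum (fun p : ι × κ => F p.1 * H p.2) (a * b) :=
  hF.mul hH (summable_mul_of_summable_norm hF.summable.norm hH.summable.norm)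

lemma hasSum_sum_two_mul_add {F : ℕ × ℕ → ℂ} {a : ℂ} (hF : HasSum F a) :
    HasSum (fun k => ∑ t ∈ Finset.range (k / 2 + 1), F (t, k - 2 * t)) a := by
  have h := hF.tsum_fiberwise fun p : ℕ × ℕ => 2 * p.1 + p.2
  refine h.congr_fun fun k => ?_
  have hset : ((fun p : ℕ × ℕ => 2 * p.1 + p.2) ⁻¹' {k}) =
      (((Finset.range (k / 2 + 1)).image fun t => (t, k - 2 * t) : Finset (ℕ × ℕ)) :
        Set (ℕ × ℕ)) := by
    ext ⟨a, b⟩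
    simp only [Set.mem_preimage, Set.mem_singleton_iff, Finset.coe_image, Set.mem_image,
      Finset.mem_coe, Finset.mem_range, Prod.mk.injEq]
    constructor
    · intro hab
      exact ⟨a, by omega, rfl, by omega⟩
    · rintro ⟨t, ht, rfl, rfl⟩
      omega
  rw [hset, Finset.tsum_subtype' _ F, Finset.sum_image fun a _ b _ hab => (Prod.mk.inj hab).1]

lemma delta_term_eq {t k : ℕ} (ht : 2 * t ≤ k) (x y T s : ℂ) :
    delta t k * (2 * x * y) ^ t * T / (k ! : ℂ) * s ^ k =
      (x * y * s ^ 2) ^ t / (t ! : ℂ) * (T / ((k - 2 * t)! : ℂ) * s ^ (k - 2 * t)) := by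
  have hf : ∀ j : ℕ, (j ! : ℂ) ≠ 0 := fun j => by exact_mod_cast j.factorial_ne_zero
  have h4 := hf k
  have h5 := hf t
  have h6 := hf (k - 2 * t)
  have hs : s ^ k = (s ^ 2) ^ t * s ^ (k - 2 * t) := by
    rw [← pow_mul, ← pow_add, Nat.add_sub_cancel' ht]
  rw [hs, delta, mul_pow, mul_pow, mul_pow, mul_pow]
  generalize (k ! : ℂ) = K at *
  generalize (t ! : ℂ) = K' at *
  generalize ((k - 2 * t)! : ℂ) = K'' at *
  generalize s ^ (k - 2 * t) = S
  field_simp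

/-- This explains δ(t,k): δ(t,k)/k! = 1/(2^t t! (k-2t)!), the 2^t cancels against (2Q(v)E_2)^t, and
what remains is the Cauchy product of exp(Q(v)E_2 s²) with the theta generating series. -/
lemma hasSum_Psi (hQ : Q.PosDef) (h : Fin n → Fin f → ℤ) (v : Fin f → ℂ) (τ : ℍ)
    (z : Fin n → ℂ) (s : ℂ) :
    HasSum (fun k : ℕ => Psi Q h v k τ z / (k ! : ℂ) * s ^ k)
      (cexp (quadC Q v * eisTwo τ * s ^ 2) * bigTheta Q τ (hvec h z + (s / (2 * π * I)) • v)) := by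
  have h1 : HasSum (fun t : ℕ => (quadC Q v * eisTwo τ * s ^ 2) ^ t / (t ! : ℂ))
      (cexp (quadC Q v * eisTwo τ * s ^ 2)) := by
    have := NormedSpace.expSeries_div_hasSum_exp (quadC Q v * eisTwo τ * s ^ 2)
    rwa [← Complex.exp_eq_exp_ℂ] at this
  have h2 := hasSum_theta hQ h v τ z s
  have h3 := hasSum_mul_prod h1 h2
  refine (hasSum_sum_two_mul_add h3).congr_fun fun k => ?_
  rw [Psi, Finset.sum_div, Finset.sum_mul]
  refine Finset.sum_congr rfl fun t ht => ?_
  exact delta_term_eq (by rw [Finset.mem_range] at ht; omega) _ _ _ _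

end Generating

/-! ### The modular transformation law -/

lemma eisTwo_smul (γ : SL(2, ℤ)) (τ : ℍ) :
    eisTwo (γ • τ) = autFactor γ τ ^ 2 *
      (eisTwo τ - (γ 1 0 : ℂ) / (2 * π * I * autFactor γ τ)) := by
  have h := congrFun (EisensteinSeries.E2_slash_action γ) τ
  have hj := autFactor_ne_zero γ τ
  have hden : denom γ τ = autFactor γ τ := by rw [ModularGroup.denom_apply, autFactor]
  have hpi : (π : ℂ) ≠ 0 := by exact_mod_cast Real.pi_ne_zero
  rw [ModularForm.SL_slash_apply, Pi.sub_apply, Pi.smul_apply, EisensteinSeries.D2, hden,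
    riemannZeta_two, smul_eq_mul] at h
  have h2 : EisensteinSeries.E2 (γ • τ) * autFactor γ τ ^ (-2 : ℤ) * autFactor γ τ ^ 2 =
      EisensteinSeries.E2 (γ • τ) := by
    rw [mul_assoc, ← zpow_natCast, ← zpow_add₀ hj]
    simp
  rw [eisTwo, eisTwo, ← h2, h]
  field_simp
  linear_combination (12 * (γ 1 0 : ℂ)) * Complex.I_sq

/-- The law of Θ at w = ∑ z_j h_j + (s/2πi)v, read coefficient by coefficient in s. Replacing s by
s/(cτ+d) produces the extra weight k. -/
theorem Psi_modular {r n N : ℕ} {Q : QuadraticForm ℤ (Fin (2 * r) → ℤ)} (hQ : Q.PosDef)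
    (hN : IsLevel Q N) {h : Fin n → Fin (2 * r) → ℤ} {v : Fin (2 * r) → ℂ}
    (hv : ∀ j, bilinC Q v (vecC (h j)) = 0) (k : ℕ) {γ : SL(2, ℤ)}
    (hγ : γ ∈ CongruenceSubgroup.Gamma0 N) (τ : ℍ) (z : Fin n → ℂ) :
    Psi Q h v k (γ • τ) (fun j => z j / autFactor γ τ) =
      (eps Q (γ 1 1) : ℂ) * autFactor γ τ ^ (k + r) *
        cexp (π * I * (γ 1 0 : ℂ) * bilinOf ((gramOf Q h).map (Int.cast : ℤ → ℝ)) z z /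
          autFactor γ τ) * Psi Q h v k τ z := by
  have hj := autFactor_ne_zero γ τ
  set j := autFactor γ τ
  set c : ℂ := (γ 1 0 : ℂ)
  have hpi : (π : ℂ) ≠ 0 := by exact_mod_cast Real.pi_ne_zero
  have hI := Complex.I_ne_zero
  have hz : (fun i => z i / j) = j⁻¹ • z := by ext i; simp [div_eq_inv_mul]
  set G := bilinOf ((gramOf Q h).map (Int.cast : ℤ → ℝ)) z z
  have key : ∀ s : ℂ, cexp (quadC Q v * eisTwo (γ • τ) * (s / j) ^ 2) *
      bigTheta Q (γ • τ : ℍ) (hvec h (j⁻¹ • z) + (s / j / (2 * π * I)) • v) =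
      (eps Q (γ 1 1) : ℂ) * j ^ r * cexp (π * I * c * G / j) *
      (cexp (quadC Q v * eisTwo τ * s ^ 2) *
        bigTheta Q τ (hvec h z + (s / (2 * π * I)) • v)) := fun s => by
    have h1 : hvec h (j⁻¹ • z) + (s / j / (2 * π * I)) • v =
        j⁻¹ • (hvec h z + (s / (2 * π * I)) • v) := by
      rw [hvec_smul, smul_add, smul_smul]
      congr 2
      field_simp
    have h2 : bilinC Q (hvec h z + (s / (2 * π * I)) • v) (hvec h z + (s / (2 * π * I)) • v) =
        G + (s / (2 * π * I)) ^ 2 * (2 * quadC Q v) := by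
      simp only [bilinC_add_left, bilinC_add_right, bilinC_smul_left, bilinC_smul_right,
        bilinC_comm Q (hvec h z) v, bilinC_hvec_eq_zero hv, bilinC_hvec_hvec, quadC]
      ring
    rw [h1, hasMult_eps hQ hN hγ τ, h2, eisTwo_smul]
    -- The term -c/(2πi j) in the law of E_2 cancels the s²-part cQ(v)s²/(2πi j) of the automorphy
    -- exponent.
    have h3 : cexp (quadC Q v * (j ^ 2 * (eisTwo τ - c / (2 * π * I * j))) * (s / j) ^ 2) *
        cexp (π * I * c * (G + (s / (2 * π * I)) ^ 2 * (2 * quadC Q v)) / j) =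
        cexp (π * I * c * G / j) * cexp (quadC Q v * eisTwo τ * s ^ 2) := by
      rw [← Complex.exp_add, ← Complex.exp_add]
      congr 1
      field_simp
      ring
    linear_combination ((eps Q (γ 1 1) : ℂ) * j ^ r *
      bigTheta Q τ (hvec h z + (s / (2 * π * I)) • v)) * h3
  have hA : ∀ s : ℂ, HasSum (fun k : ℕ => Psi Q h v k (γ • τ) (j⁻¹ • z) / (k ! : ℂ) / j ^ k * s ^ k)
      ((eps Q (γ 1 1) : ℂ) * j ^ r * cexp (π * I * c * G / j) *
      (cexp (quadC Q v * eisTwo τ * s ^ 2) *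
        bigTheta Q τ (hvec h z + (s / (2 * π * I)) • v))) := fun s => by
    rw [← key]
    refine (hasSum_Psi hQ h v (γ • τ) (j⁻¹ • z) (s / j)).congr_fun fun k => ?_
    rw [div_pow]
    ring
  have hB : ∀ s : ℂ, HasSum (fun k : ℕ => (eps Q (γ 1 1) : ℂ) * j ^ r *
        cexp (π * I * c * G / j) * (Psi Q h v k τ z / (k ! : ℂ)) * s ^ k)
      ((eps Q (γ 1 1) : ℂ) * j ^ r * cexp (π * I * c * G / j) *
      (cexp (quadC Q v * eisTwo τ * s ^ 2) *
        bigTheta Q τ (hvec h z + (s / (2 * π * I)) • v))) := fun s => by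
    refine ((hasSum_Psi hQ h v τ z s).mul_left ((eps Q (γ 1 1) : ℂ) * j ^ r *
      cexp (π * I * c * G / j))).congr_fun fun k => ?_
    ring
  have hk := congrFun (eq_of_hasSum_pow hA hB) k
  have hf : (k ! : ℂ) ≠ 0 := by exact_mod_cast k.factorial_ne_zero
  rw [hz, pow_add]
  generalize Psi Q h v k (γ • τ) (j⁻¹ • z) = x at hk ⊢
  field_simp at hk
  linear_combination hk

/-! ### Holomorphy -/

section Holomorphy

variable {f n : ℕ} {Q : QuadraticForm ℤ (Fin f → ℤ)}

lemma exists_norm_bilinC_le (Q : QuadraticForm ℤ (Fin f → ℤ)) :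
    ∃ C : ℝ, 0 ≤ C ∧ ∀ x y : Fin f → ℂ, ‖bilinC Q x y‖ ≤ C * (‖x‖ * ‖y‖) := by
  let T : (Fin f → ℂ) →L[ℂ] (Fin f → ℂ) :=
    LinearMap.toContinuousLinearMap (Matrix.mulVecLin ((gram Q).map (Int.cast : ℤ → ℂ)))
  refine ⟨f * ‖T‖, by positivity, fun x y => ?_⟩
  have h1 : ‖(gram Q).map (Int.cast : ℤ → ℂ) *ᵥ y‖ ≤ ‖T‖ * ‖y‖ := T.le_opNorm y
  refine (norm_dotProduct_le _ _).trans ?_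
  calc _ ≤ f * (‖x‖ * (‖T‖ * ‖y‖)) := by gcongr
    _ = _ := by ring

/-- `z ↦ ∑_j z_j h_j` as a continuous linear map. -/
def hvecL (h : Fin n → Fin f → ℤ) : (Fin n → ℂ) →L[ℂ] (Fin f → ℂ) :=
  LinearMap.toContinuousLinearMap
    { toFun := hvec h
      map_add' := hvec_add h
      map_smul' := hvec_smul h }

/-- The exponent of the summand of the theta series at `m`, as a linear map in `(τ, z)`. -/
def expoL (Q : QuadraticForm ℤ (Fin f → ℤ)) (h : Fin n → Fin f → ℤ) (m : Fin f → ℤ) :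
    ℂ × (Fin n → ℂ) →L[ℂ] ℂ :=
  LinearMap.toContinuousLinearMap
    { toFun := fun p => 2 * π * I * (p.1 * Q m + bilinC Q (vecC m) (hvec h p.2))
      map_add' := fun p q => by
        rw [Prod.snd_add, Prod.fst_add, hvec_add, bilinC_add_right]
        ring
      map_smul' := fun a p => by
        rw [Prod.smul_snd, Prod.smul_fst, hvec_smul, bilinC_smul_right, smul_eq_mul, smul_eq_mul,
          RingHom.id_apply]
        ring }

lemma expoL_apply (Q : QuadraticForm ℤ (Fin f → ℤ)) (h : Fin n → Fin f → ℤ) (m : Fin f → ℤ)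
    (p : ℂ × (Fin n → ℂ)) :
    expoL Q h m p = 2 * π * I * (p.1 * Q m + bilinC Q (vecC m) (hvec h p.2)) := rfl

/-- The quadratic growth in m is weakened to e^{‖m‖}, which the Gaussian bound absorbs when
differentiating termwise. -/
lemma exists_norm_expoL_le (Q : QuadraticForm ℤ (Fin f → ℤ)) (h : Fin n → Fin f → ℤ) :
    ∃ K : ℝ, 0 ≤ K ∧ ∀ m : Fin f → ℤ, ‖expoL Q h m‖ ≤ K * Real.exp ‖m‖ := by
  obtain ⟨C, hC, hb⟩ := exists_norm_bilinC_le Q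
  have hpi := Real.pi_pos
  refine ⟨2 * π * (C + C * ‖hvecL h‖), by positivity, fun m => ?_⟩
  have h1 : ‖m‖ ≤ Real.exp ‖m‖ := by linarith [Real.add_one_le_exp ‖m‖]
  have h2 : ‖m‖ ^ 2 ≤ 2 * Real.exp ‖m‖ := by
    simpa using pow_le_factorial_mul_exp (norm_nonneg m) 2
  have hQ : ‖(Q m : ℂ)‖ ≤ C * Real.exp ‖m‖ := by
    have h3 := hb (vecC m) (vecC m)
    rw [bilinC_vecC_self, norm_vecC, norm_mul, Complex.norm_ofNat, ← sq] at h3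
    have := mul_le_mul_of_nonneg_left h2 hC
    linarith
  refine ContinuousLinearMap.opNorm_le_bound _ (by positivity) fun p => ?_
  rw [expoL_apply, norm_mul, norm_mul, norm_mul, Complex.norm_ofNat, Complex.norm_I,
    Complex.norm_real, Real.norm_of_nonneg hpi.le, mul_one]
  have h4 : ‖p.1 * (Q m : ℂ)‖ ≤ C * Real.exp ‖m‖ * ‖p‖ := by
    rw [norm_mul, mul_comm]
    exact mul_le_mul hQ (norm_fst_le p) (norm_nonneg _) (by positivity)
  have h5 : ‖bilinC Q (vecC m) (hvec h p.2)‖ ≤ C * ‖hvecL h‖ * Real.exp ‖m‖ * ‖p‖ := by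
    refine (hb _ _).trans ?_
    rw [norm_vecC]
    have h6 : ‖hvec h p.2‖ ≤ ‖hvecL h‖ * ‖p‖ :=
      ((hvecL h).le_opNorm p.2).trans (mul_le_mul_of_nonneg_left (norm_snd_le p) (norm_nonneg _))
    calc C * (‖m‖ * ‖hvec h p.2‖) ≤ C * (Real.exp ‖m‖ * (‖hvecL h‖ * ‖p‖)) := by gcongr
      _ = _ := by ring
  calc 2 * π * ‖p.1 * (Q m : ℂ) + bilinC Q (vecC m) (hvec h p.2)‖
      ≤ 2 * π * (C * Real.exp ‖m‖ * ‖p‖ + C * ‖hvecL h‖ * Real.exp ‖m‖ * ‖p‖) := by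
        gcongr
        exact (norm_add_le _ _).trans (add_le_add h4 h5)
    _ = _ := by ring

lemma differentiableOn_theta (hQ : Q.PosDef) (h : Fin n → Fin f → ℤ) (v : Fin f → ℂ) (l : ℕ) :
    DifferentiableOn ℂ (fun p : ℂ × (Fin n → ℂ) => theta Q h v l (ofComplex p.1) p.2)
      {p | 0 < p.1.im} := by
  have hcongr : ∀ p ∈ {p : ℂ × (Fin n → ℂ) | 0 < p.1.im}, theta Q h v l (ofComplex p.1) p.2 =
      ∑' m, bilinC Q v (vecC m) ^ l * cexp (expoL Q h m p) := fun p hp => by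
    refine tsum_congr fun m => ?_
    rw [thetaTerm_eq, expoL_apply, UpperHalfPlane.ofComplex_apply_of_im_pos hp]
  refine DifferentiableOn.congr (fun x hx => ?_) hcongr
  have hx : 0 < x.1.im := hx
  set ε := x.1.im / 2
  -- A convex open neighbourhood on which one Gaussian bounds all the differentiated terms.
  set s : Set (ℂ × (Fin n → ℂ)) := {τ | ε < τ.im} ×ˢ Metric.ball 0 (‖x.2‖ + 1)
  have hxs : x ∈ s := ⟨half_lt_self hx, by simp⟩
  have hso : IsOpen s := (isOpen_lt (by fun_prop) (by fun_prop)).prod Metric.isOpen_ball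
  have hsc : IsPreconnected s := (convex_halfSpace_im_gt ε).isPreconnected.prod
    (convex_ball (0 : Fin n → ℂ) (‖x.2‖ + 1)).isPreconnected
  obtain ⟨c, C, hc, hb⟩ := exists_norm_bigTheta_term_le hQ (half_pos hx)
    (‖hvecL h‖ * (‖x.2‖ + 1))
  obtain ⟨D, hD, hd⟩ := norm_bilinC_le Q v
  obtain ⟨K, hK, hk⟩ := exists_norm_expoL_le Q h
  have hpow : ∀ m : Fin f → ℤ, ‖bilinC Q v (vecC m) ^ l‖ ≤ (l ! : ℝ) * Real.exp (D * ‖m‖) :=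
    fun m => by
      rw [norm_pow]
      exact (pow_le_pow_left₀ (norm_nonneg _) (hd m) l).trans
        (pow_le_factorial_mul_exp (by positivity) l)
  have hu : Summable fun m : Fin f → ℤ =>
      (l ! : ℝ) * K * Real.exp (-c * ‖m‖ ^ 2 + (C + D + 1) * ‖m‖) :=
    (summable_exp_neg_norm_sq hc _).mul_left _
  refine (hasFDerivAt_tsum_of_isPreconnected hu hso hsc
    (f' := fun m p => bilinC Q v (vecC m) ^ l • (cexp (expoL Q h m p) • expoL Q h m))
    (fun m p _ => ((expoL Q h m).hasFDerivAt.cexp).const_mul _) (fun m p hp => ?_) hxs ?_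
    hxs).differentiableAt.differentiableWithinAt
  · rw [norm_smul, norm_smul, expoL_apply]
    have h1 := hb p.1 (hvec h p.2) hp.1.le
      (((hvecL h).le_opNorm p.2).trans (mul_le_mul_of_nonneg_left
        (mem_ball_zero_iff.1 hp.2).le (norm_nonneg _))) m
    calc _ ≤ (l ! : ℝ) * Real.exp (D * ‖m‖) *
          (Real.exp (-c * ‖m‖ ^ 2 + C * ‖m‖) * (K * Real.exp ‖m‖)) := by
          gcongr
          · exact hpow m
          · exact hk m
      _ = (l ! : ℝ) * K * (Real.exp (D * ‖m‖) * Real.exp (-c * ‖m‖ ^ 2 + C * ‖m‖) *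
          Real.exp ‖m‖) := by ring
      _ = _ := by
        rw [← Real.exp_add, ← Real.exp_add]
        ring_nf
  · refine (summable_thetaTerm hQ h v l ⟨x.1, hx⟩ x.2).congr fun m => ?_
    rw [thetaTerm_eq, expoL_apply]

lemma differentiableOn_eisTwo :
    DifferentiableOn ℂ (fun p : ℂ × (Fin n → ℂ) => eisTwo (ofComplex p.1)) {p | 0 < p.1.im} := by
  have h := UpperHalfPlane.mdifferentiable_iff.1 E2_mdifferentiable
  exact (DifferentiableOn.comp (g := EisensteinSeries.E2 ∘ ofComplex)
    (f := fun p : ℂ × (Fin n → ℂ) => p.1) h differentiableOn_fst fun p hp => hp).const_mul _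

theorem differentiableOn_Psi (hQ : Q.PosDef) (h : Fin n → Fin f → ℤ) (v : Fin f → ℂ) (k : ℕ) :
    DifferentiableOn ℂ (fun p : ℂ × (Fin n → ℂ) => Psi Q h v k (ofComplex p.1) p.2)
      {p | 0 < p.1.im} := by
  unfold Psi
  exact DifferentiableOn.fun_sum fun t _ =>
    (((differentiableOn_eisTwo.const_mul _).pow t).const_mul _).mul
      (differentiableOn_theta hQ h v _)

end Holomorphy

/-! ### Fourier expansions -/

section Expansion

variable {f n : ℕ} {Q : QuadraticForm ℤ (Fin f → ℤ)}

/-- The function `q^ℓ exp(2πi zᵀν)`. -/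
def fourierTerm (τ : ℍ) (z : Fin n → ℂ) (p : ℚ × (Fin n → ℤ)) : ℂ :=
  cexp (2 * π * I * ((p.1 : ℂ) * τ)) * cexp (2 * π * I * (z ⬝ᵥ vecC p.2))

/-- `Φ` is an absolutely convergent series of multiples of `q^ℓ exp(2πi zᵀν)` with
`(ℓ, ν) ∈ S`; the same `(ℓ, ν)` may occur several times. -/
def HasExpansion (S : Set (ℚ × (Fin n → ℤ))) (Φ : ℍ → (Fin n → ℂ) → ℂ) : Prop :=
  ∃ (ι : Type) (a : ι → ℂ) (e : ι → ℚ × (Fin n → ℤ)), (∀ i, e i ∈ S) ∧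
    ∀ τ z, HasSum (fun i => a i * fourierTerm τ z (e i)) (Φ τ z)

namespace HasExpansion

variable {S : Set (ℚ × (Fin n → ℤ))} {Φ Ψ : ℍ → (Fin n → ℂ) → ℂ}

lemma zero : HasExpansion S (fun _ _ => 0) :=
  ⟨Empty, fun _ => 0, fun i => i.elim, fun i => i.elim, fun τ z => by simp⟩

lemma add (hΦ : HasExpansion S Φ) (hΨ : HasExpansion S Ψ) :
    HasExpansion S (fun τ z => Φ τ z + Ψ τ z) := by
  obtain ⟨ι, a, e, he, ha⟩ := hΦ
  obtain ⟨κ, b, d, hd, hb⟩ := hΨ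
  refine ⟨ι ⊕ κ, Sum.elim a b, Sum.elim e d, ?_, fun τ z => ?_⟩
  · rintro (i | i)
    exacts [he i, hd i]
  · exact HasSum.sum (ha τ z) (hb τ z)

lemma sum {κ : Type*} (s : Finset κ) {Φ : κ → ℍ → (Fin n → ℂ) → ℂ}
    (hΦ : ∀ i ∈ s, HasExpansion S (Φ i)) : HasExpansion S (fun τ z => ∑ i ∈ s, Φ i τ z) := by
  classical
  induction s using Finset.induction_on with
  | empty => simpa using zero
  | insert i s hi ih =>
    simp only [Finset.sum_insert hi]
    exact (hΦ i (Finset.mem_insert_self i s)).add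
      (ih fun j hj => hΦ j (Finset.mem_insert_of_mem hj))

lemma const_mul (hΦ : HasExpansion S Φ) (c : ℂ) : HasExpansion S (fun τ z => c * Φ τ z) := by
  obtain ⟨ι, a, e, he, ha⟩ := hΦ
  refine ⟨ι, fun i => c * a i, e, he, fun τ z => ?_⟩
  simpa only [mul_assoc] using (ha τ z).mul_left c

lemma fourierTerm_add_nat (τ : ℍ) (z : Fin n → ℂ) (p : ℚ × (Fin n → ℤ)) (m : ℕ) :
    fourierTerm τ z (p.1 + m, p.2) = cexp (2 * π * I * τ) ^ m * fourierTerm τ z p := by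
  rw [fourierTerm, fourierTerm, ← Complex.exp_nat_mul, ← Complex.exp_add, ← Complex.exp_add,
    ← Complex.exp_add]
  congr 1
  simp only [Rat.cast_add, Rat.cast_natCast]
  ring

/-- Multiplying by the q-expansion of E_2 only raises ℓ by natural numbers. -/
lemma E2_mul (hS : ∀ p ∈ S, ∀ m : ℕ, (p.1 + (m : ℚ), p.2) ∈ S) (hΦ : HasExpansion S Φ) :
    HasExpansion S (fun τ z => EisensteinSeries.E2 τ * Φ τ z) := by
  obtain ⟨ι, a, e, he, ha⟩ := hΦ
  refine ⟨ℕ × ι, fun p => (if p.1 = 0 then 1 else -24 * (ArithmeticFunction.sigma 1 p.1 : ℂ)) *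
    a p.2, fun p => ((e p.2).1 + p.1, (e p.2).2), fun p => hS _ (he p.2) p.1, fun τ z => ?_⟩
  refine (hasSum_mul_prod (EisensteinSeries.hasSum_qExpansion_E2 (z := τ)) (ha τ z)).congr_fun
    fun p => ?_
  rw [fourierTerm_add_nat, smul_eq_mul]
  ring

lemma eisTwo_mul (hS : ∀ p ∈ S, ∀ m : ℕ, (p.1 + (m : ℚ), p.2) ∈ S) (hΦ : HasExpansion S Φ) :
    HasExpansion S (fun τ z => eisTwo τ * Φ τ z) := by
  simpa only [eisTwo, mul_assoc] using (hΦ.E2_mul hS).const_mul (-(1 / 12))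

lemma eisTwo_pow_mul (hS : ∀ p ∈ S, ∀ m : ℕ, (p.1 + (m : ℚ), p.2) ∈ S)
    (hΦ : HasExpansion S Φ) (t : ℕ) : HasExpansion S (fun τ z => eisTwo τ ^ t * Φ τ z) := by
  induction t with
  | zero => simpa using hΦ
  | succ t ih =>
    simpa only [pow_succ', mul_assoc] using ih.eisTwo_mul hS

/-- Terms with equal (ℓ, ν) are collected; off S the fibre is empty, so the coefficient is zero. -/
lemma exists_coeff (hΦ : HasExpansion S Φ) : ∃ c : ℚ → (Fin n → ℤ) → ℂ,
    (∀ ℓ ν, c ℓ ν ≠ 0 → (ℓ, ν) ∈ S) ∧ ∀ (τ : ℍ) (z : Fin n → ℂ),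
      HasSum (fun p : ℚ × (Fin n → ℤ) =>
        c p.1 p.2 * cexp (2 * π * I * ((p.1 : ℂ) * τ)) * cexp (2 * π * I * (z ⬝ᵥ vecC p.2)))
        (Φ τ z) := by
  obtain ⟨ι, a, e, he, ha⟩ := hΦ
  refine ⟨fun ℓ ν => ∑' i : e ⁻¹' {(ℓ, ν)}, a i, fun ℓ ν hc => ?_, fun τ z => ?_⟩
  · by_contra hS
    refine hc ?_
    have : IsEmpty (e ⁻¹' {(ℓ, ν)}) := ⟨fun i => hS (i.2 ▸ he i)⟩
    exact tsum_empty
  · refine ((ha τ z).tsum_fiberwise e).congr_fun fun p => ?_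
    rw [mul_assoc]
    change _ * fourierTerm τ z p = _
    rw [← tsum_mul_right]
    refine tsum_congr fun i => ?_
    rw [show e i = p from i.2]

end HasExpansion

/-! ### The index -/

variable {h : Fin n → Fin f → ℤ}

lemma gramOf_posDef (hQ : Q.PosDef) (hh : LinearIndependent ℤ h) :
    ((gramOf Q h).map (Int.cast : ℤ → ℝ)).PosDef := by
  refine posDef_intCast ?_ fun x hx => ?_
  · ext i j
    simp [gramOf, QuadraticMap.polar_comm]
  -- G[x] is twice Q at ∑ x_j h_j, a vector that linear independence keeps nonzero.
  · have h1 : x ⬝ᵥ gramOf Q h *ᵥ x = 2 * Q (∑ j, x j • h j) := by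
      have := bilinC_hvec_hvec Q h (vecC x) (vecC x)
      rw [hvec_vecC, bilinC_vecC_self] at this
      have h2 : bilinOf ((gramOf Q h).map (Int.cast : ℤ → ℝ)) (vecC x) (vecC x) =
          ((x ⬝ᵥ gramOf Q h *ᵥ x : ℤ) : ℂ) := by
        simp [bilinOf, dotProduct, Matrix.mulVec, vecC]
      rw [h2] at this
      exact_mod_cast this.symm
    rw [h1]
    refine mul_pos two_pos (hQ _ fun h0 => hx ?_)
    funext j
    exact Fintype.linearIndependent_iff.1 hh x h0 j

/-- The expression is B(u,u) for the real vector u = m + ∑ y_j h_j. -/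
lemma nonneg_apply_add_hvec (hQ : Q.PosDef) (m : Fin f → ℤ) (y : Fin n → ℝ) :
    0 ≤ 2 * (Q m : ℝ) + 2 * (y ⬝ᵥ fun j => ((QuadraticMap.polar Q m (h j) : ℤ) : ℝ)) +
      y ⬝ᵥ (gramOf Q h).map (Int.cast : ℤ → ℝ) *ᵥ y := by
  set u : Fin f → ℝ := fun i => m i + ∑ j, y j * h j i
  have hu : (fun i => (u i : ℂ)) = vecC m + hvec h fun j => (y j : ℂ) := by
    ext i
    simp [u, hvec, vecC]
  have h1 : ((u ⬝ᵥ gramR Q *ᵥ u : ℝ) : ℂ) = ((2 * (Q m : ℝ) +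
      2 * (y ⬝ᵥ fun j => ((QuadraticMap.polar Q m (h j) : ℤ) : ℝ)) +
      y ⬝ᵥ (gramOf Q h).map (Int.cast : ℤ → ℝ) *ᵥ y : ℝ) : ℂ) := by
    rw [← qf_ofReal, qf_gramR, hu, bilinC_add_left, bilinC_add_right, bilinC_add_right,
      bilinC_comm Q (hvec h _) (vecC m), bilinC_vecC_self, bilinC_hvec_hvec, bilinC_hvec_right]
    simp only [bilinC_vecC]
    rw [Complex.ofReal_add, ← qf_ofReal, qf, bilinOf]
    simp only [dotProduct]
    push_cast
    ring
  rw [← Complex.ofReal_injective h1]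
  simpa using (gramR_posDef hQ).posSemidef.dotProduct_mulVec_nonneg u

/-- The pairs `(ℓ, ν)` allowed in the expansion of a Jacobi form of index `F`. -/
def jacobiSupport (F : Matrix (Fin n) (Fin n) ℝ) : Set (ℚ × (Fin n → ℤ)) :=
  {p | 0 ≤ p.1 ∧
    0 ≤ 4 * (p.1 : ℝ) - (fun i => (p.2 i : ℝ)) ⬝ᵥ F⁻¹ *ᵥ (fun i => (p.2 i : ℝ))}

lemma add_nat_mem_jacobiSupport {F : Matrix (Fin n) (Fin n) ℝ} (p : ℚ × (Fin n → ℤ))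
    (hp : p ∈ jacobiSupport F) (m : ℕ) : (p.1 + (m : ℚ), p.2) ∈ jacobiSupport F := by
  obtain ⟨h1, h2⟩ := hp
  refine ⟨by positivity, h2.trans ?_⟩
  push_cast
  have : (0 : ℝ) ≤ m := m.cast_nonneg
  linarith

lemma mem_jacobiSupport (hQ : Q.PosDef) (hh : LinearIndependent ℤ h) (m : Fin f → ℤ) :
    ((Q m : ℚ), fun j => QuadraticMap.polar Q m (h j)) ∈
      jacobiSupport ((1 / 2 : ℝ) • (gramOf Q h).map (Int.cast : ℤ → ℝ)) := by
  set G := (gramOf Q h).map (Int.cast : ℤ → ℝ) with hG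
  set F := (1 / 2 : ℝ) • G with hF
  have hFdet : IsUnit F.det :=
    ((Matrix.isUnit_iff_isUnit_det _).1 ((gramOf_posDef hQ hh).smul one_half_pos).isUnit)
  set w : Fin n → ℝ := fun j => ((QuadraticMap.polar Q m (h j) : ℤ) : ℝ)
  have hQm : 0 ≤ Q m := by
    rcases eq_or_ne m 0 with rfl | hm
    · simp
    · exact (hQ m hm).le
  refine ⟨Int.cast_nonneg hQm, ?_⟩
  change 0 ≤ 4 * (((Q m : ℚ)) : ℝ) - w ⬝ᵥ F⁻¹ *ᵥ w
  set y := F⁻¹ *ᵥ w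
  have hy : G *ᵥ y = (2 : ℝ) • w := by
    have h1 : F *ᵥ y = w := by
      rw [Matrix.mulVec_mulVec, Matrix.mul_nonsing_inv _ hFdet, Matrix.one_mulVec]
    rw [← h1, hF, Matrix.smul_mulVec, smul_smul]
    norm_num
  -- With ν = (B(m,h_j))_j this is the minimiser -G⁻¹ν; the minimum 2Q(m) - G⁻¹[ν] ≥ 0, doubled, is
  -- the required inequality since F⁻¹ = 2G⁻¹.
  have h2 := nonneg_apply_add_hvec (h := h) hQ m ((-(1 / 2) : ℝ) • y)
  rw [← hG, Matrix.mulVec_smul, hy] at h2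
  simp only [smul_dotProduct, dotProduct_smul, smul_eq_mul] at h2
  rw [dotProduct_comm y] at h2
  push_cast
  linarith

lemma hasExpansion_theta (hQ : Q.PosDef) (hh : LinearIndependent ℤ h) (v : Fin f → ℂ) (l : ℕ) :
    HasExpansion (jacobiSupport ((1 / 2 : ℝ) • (gramOf Q h).map (Int.cast : ℤ → ℝ)))
      (theta Q h v l) := by
  refine ⟨Fin f → ℤ, fun m => bilinC Q v (vecC m) ^ l,
    fun m => ((Q m : ℚ), fun j => QuadraticMap.polar Q m (h j)),
    fun m => mem_jacobiSupport hQ hh m, fun τ z => ?_⟩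
  refine (summable_thetaTerm hQ h v l τ z).hasSum.congr_fun fun m => ?_
  rw [thetaTerm_eq, fourierTerm, ← Complex.exp_add, bilinC_hvec_right]
  congr 2
  simp only [bilinC_vecC, dotProduct, vecC]
  push_cast
  ring

lemma hasExpansion_Psi (hQ : Q.PosDef) (hh : LinearIndependent ℤ h) (v : Fin f → ℂ) (k : ℕ) :
    HasExpansion (jacobiSupport ((1 / 2 : ℝ) • (gramOf Q h).map (Int.cast : ℤ → ℝ)))
      (Psi Q h v k) := by
  refine HasExpansion.sum (Finset.range (k / 2 + 1)) (Φ := fun t τ z =>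
    delta t k * (2 * quadC Q v * eisTwo τ) ^ t * theta Q h v (k - 2 * t) τ z) fun t _ => ?_
  have := (((hasExpansion_theta hQ hh v (k - 2 * t)).eisTwo_pow_mul
    add_nat_mem_jacobiSupport t).const_mul (delta t k * (2 * quadC Q v) ^ t))
  simpa only [mul_pow, mul_assoc] using this

end Expansion

end JacobiTheta
end

/-! ### The Jacobi form of index G/2 -/

theorem theorem2 (r n N k : ℕ)
    (Q : QuadraticForm ℤ (Fin (2 * r) → ℤ)) (hQ : Q.PosDef) (hN : JacobiTheta.IsLevel Q N)
    (h : Fin n → Fin (2 * r) → ℤ) (hh : LinearIndependent ℤ h)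
    (v : Fin (2 * r) → ℂ)
    (hv : ∀ j, JacobiTheta.bilinC Q v (JacobiTheta.vecC (h j)) = 0) :
    -- all the theta series converge absolutely
    (∀ (l : ℕ) (τ : ℍ) (z : Fin n → ℂ), Summable (JacobiTheta.thetaTerm Q h v l τ z)) ∧
    -- transformation law under `Γ_0(N)`
    (∀ γ ∈ CongruenceSubgroup.Gamma0 N, ∀ (τ : ℍ) (z : Fin n → ℂ),
      JacobiTheta.Psi Q h v k (γ • τ) (fun j => z j / JacobiTheta.autFactor γ τ) =
        (JacobiTheta.eps Q (γ 1 1) : ℂ) * JacobiTheta.autFactor γ τ ^ (k + r) *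
          cexp (π * I * (γ 1 0 : ℂ) *
            JacobiTheta.bilinOf ((JacobiTheta.gramOf Q h).map (Int.cast : ℤ → ℝ)) z z /
              JacobiTheta.autFactor γ τ) *
          JacobiTheta.Psi Q h v k τ z) ∧
    -- transformation law under `ℤ^n × ℤ^n`
    (∀ (lam mu : Fin n → ℤ) (τ : ℍ) (z : Fin n → ℂ),
      JacobiTheta.Psi Q h v k τ (fun j => z j + (lam j : ℂ) * τ + (mu j : ℂ)) =
        cexp (-(π * I *
          (JacobiTheta.bilinOf ((JacobiTheta.gramOf Q h).map (Int.cast : ℤ → ℝ))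
              (JacobiTheta.vecC lam) (JacobiTheta.vecC lam) * τ +
            2 * JacobiTheta.bilinOf ((JacobiTheta.gramOf Q h).map (Int.cast : ℤ → ℝ))
              z (JacobiTheta.vecC lam)))) *
          JacobiTheta.Psi Q h v k τ z) ∧
    -- `Ψ` is a Jacobi form of weight `k + r`, index `G/2` and character `ε`
    (∃ χ : CongruenceSubgroup.Gamma0 N →* ℂˣ,
      (∀ γ : CongruenceSubgroup.Gamma0 N,
        (χ γ : ℂ) = (JacobiTheta.eps Q ((γ : SL(2, ℤ)) 1 1) : ℂ)) ∧
      JacobiTheta.IsJacobiForm (CongruenceSubgroup.Gamma0 N) ((k + r : ℕ) : ℤ)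
        ((1 / 2 : ℝ) • (JacobiTheta.gramOf Q h).map (Int.cast : ℤ → ℝ)) χ
        (JacobiTheta.Psi Q h v k)) := by
  have hhalf : ∀ x y, JacobiTheta.bilinOf
      ((1 / 2 : ℝ) • (JacobiTheta.gramOf Q h).map (Int.cast : ℤ → ℝ)) x y =
      JacobiTheta.bilinOf ((JacobiTheta.gramOf Q h).map (Int.cast : ℤ → ℝ)) x y / 2 :=
    fun x y => by
      have : ((1 / 2 : ℝ) • (JacobiTheta.gramOf Q h).map (Int.cast : ℤ → ℝ)).map
          (Complex.ofReal : ℝ → ℂ) = (1 / 2 : ℂ) •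
          ((JacobiTheta.gramOf Q h).map (Int.cast : ℤ → ℝ)).map (Complex.ofReal : ℝ → ℂ) := by
        ext i j
        simp
      rw [JacobiTheta.bilinOf, this, Matrix.smul_mulVec, dotProduct_smul, JacobiTheta.bilinOf,
        smul_eq_mul]
      ring
  refine ⟨fun l τ z => JacobiTheta.summable_thetaTerm hQ h v l τ z,
    fun γ hγ τ z => JacobiTheta.Psi_modular hQ hN hv k hγ τ z,
    fun lam mu τ z => JacobiTheta.Psi_elliptic hv k lam mu τ z,
    JacobiTheta.epsChar hQ hN, fun γ => JacobiTheta.epsChar_apply hQ hN γ, ?_⟩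
  refine ⟨(JacobiTheta.gramOf_posDef hQ hh).smul one_half_pos,
    JacobiTheta.differentiableOn_Psi hQ h v k,
    (JacobiTheta.hasExpansion_Psi hQ hh v k).exists_coeff, fun γ τ z => ?_,
    fun lam mu τ z => ?_⟩
  · rw [JacobiTheta.Psi_modular hQ hN hv k γ.2, JacobiTheta.epsChar_apply, zpow_natCast, hhalf]
    congr 3
    ring
  · rw [JacobiTheta.Psi_elliptic hv, hhalf, hhalf]
    congr 2
    ring
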